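/- Fix $c>0$, $\lambda,\delta,p_0\in(0,1)$ and $m$ with $g:=\lambda m-c>0$. A state $\theta\in\{G,B\}$ is drawn with $P(\theta=G)=p_0$. Two players move alternately, player 1 first; the mover chooses the safe arm $S$ (payoff $0$) or the risky arm $R$ ("experiments"). An experiment costs $c$; it yields $m$ ("success") with probability $\lambda$, independently across experiments, if $\theta=G$, and always yields $0$ if $\theta=B$. Choices are public, outcomes are observed only by the mover. Payoffs are discounted by $\delta$ per period, a period being two consecutive moves. A public history $h$ is a finite word in $\{R,S\}$, and $n_e(h)$ is its number of $R$'s. A private history of player $i$ consists of the public history and the outcomes of $i$'s experiments; a full history consists of $\theta$, all choices and all outcomes. A strategy assigns a mixed move to each private history at which the player is active. A belief system $\pi$ assigns to each private history a probability distribution on full histories. A pair $(\sigma,\pi)$ is a sequential equilibrium (SE) if (i) at each private history where a player is active, his strategy maximizes his expected discounted continuation payoff given his belief and the other player's strategy, and (ii) there are completely mixed profiles $\tau_n\to\sigma$ (pointwise) whose Bayesian beliefs converge pointwise to $\pi$. Let $p^i(h)$ be the probability that $i$ assigns to $\theta=G$ when the public history is $h$ and none of $i$'s experiments was successful; let $\sigma(R\mid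 h)$ be the probability with which the player active at $h$ plays $R$ when the public history is $h$ and none of his experiments was successful. Let $\phi(p)=\frac{p(1-\lambda)}{p(1-\lambda)+1-p}$. The SE is reasonable if for every public history $h$ and every $a\in\{R,S\}$, $p^i(hS)=\phi^{n_e(h)}(p_0)$ for the player $i$ active at $hS$, and $p^i(hSaR)=\phi^{n_e(hSa)}(p_0)$ for the player $i$ active at $hSaR$. The final belief of a player along an infinite play is the limit, if it exists, of the probability he assigns to $\theta=G$ at his successive private histories. Let $$p^*=\frac{c(1-\delta)}{c(1-\delta)+g(1-\delta(1-\lambda))},\qquad \widehat p=\frac{c(1-\delta)}{c(1-\delta)+g\bigl(1-\delta+\lambda\delta(1+\delta-\lambda\delta)\bigr)}.$$ Theorem. Let $(\sigma,\pi)$ be a reasonable SE. 1. If $p_0>p^*$, then with positive $\mathbf P_\sigma$-probability the final beliefs of both players exist and are at most $\widehat p$; if moreover $\phi^n(p_0)\neq\widehat p$ for all $n\ge 0$, then with positive $\mathbf P_\sigma$-probability they exist and are strictly less than $\widehat p$. 2. For every public history $h$ at which the active player $i$ has $p^i(h)<\widehat p$, one has $\sigma(R\mid h)=0$. -/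

import Mathlib

open Filter Topology MeasureTheory ProbabilityTheory

/-- Parameters of the experimentation game: prior `p0 = P(θ = G)`, success probability `lam` of the
good risky arm, prize `m`, cost `c` of the risky arm, discount factor `δ` between periods. -/
structure ExpGame where
  p0 : ℝ
  lam : ℝ
  m : ℝ
  c : ℝ
  δ : ℝ
  p0_pos : 0 < p0
  p0_lt_one : p0 < 1
  lam_pos : 0 < lam
  lam_lt_one : lam < 1
  c_pos : 0 < c
  δ_pos : 0 < δ
  δ_lt_one : δ < 1
  g_pos : 0 < lam * m - c

namespace ExpGame

/-- Type `θ` of the risky arm. -/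
inductive State
  | G
  | B
  deriving DecidableEq

/-- The safe arm `S` and the risky arm `R`. -/
inductive Arm
  | S
  | R
  deriving DecidableEq

/-- A move together with its outcome: the safe arm, or an experiment that succeeded (`true`) or
failed (`false`). -/
inductive Move
  | safe
  | risky (success : Bool)
  deriving DecidableEq

/-- The publicly observed part of a move. -/
def Move.arm : Move → Arm
  | .safe => .S
  | .risky _ => .R

/-- The move with arm `a` in which an experiment, if any, fails. -/
def Arm.failed : Arm → Move
  | .S => .safe
  | .R => .risky false

/-- Full histories: the state, and the past moves with all outcomes.
Throughout, histories are lists with the MOST RECENT entry FIRST; `a :: h` is "`h` followed by `a`". -/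
structure FullHist where
  state : State
  moves : List Move

instance : MeasurableSpace FullHist := ⊤

instance : DiscreteMeasurableSpace FullHist := ⟨fun _ => trivial⟩

/-- The two players; player `0` moves first. -/
abbrev Player := Fin 2

/-- The player who is active after `n` moves. -/
def active (n : ℕ) : Player := if Even n then 0 else 1

/-- Private histories of a player: an own move is observed with its outcome (`Sum.inl`), of a move
of the other player only the arm is observed (`Sum.inr`). The private histories of player `i` are
the lists of the form `view i h`. -/
abbrev PrivHist := List (Move ⊕ Arm)

/-- The private history of player `i` when the past moves are `h`. -/
def view (i : Player) : List Move → PrivHist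
  | [] => []
  | x :: h => (if active h.length = i then Sum.inl x else Sum.inr x.arm) :: view i h

/-- The private history of player `i` at which the public history is `h` and all past experiments
of `i` failed (the outcomes of the other player are not visible in it). -/
def failView (i : Player) (h : List Arm) : PrivHist := view i (h.map Arm.failed)

/-- A behavior strategy: a mixed move at each private history. -/
abbrev Strategy := PrivHist → PMF Arm

/-- A strategy for each player. -/
abbrev Profile := Player → Strategy

/-- A belief system: for each player and each private history, a distribution on full histories. -/
abbrev Beliefs := Player → PrivHist → PMF FullHist

/-- The distribution of a coin that shows `true` with probability `p`. -/
noncomputable def coin (p : ℝ) (h0 : 0 ≤ p) (h1 : p ≤ 1) : PMF Bool :=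
  PMF.ofFintype (fun b => if b then ENNReal.ofReal p else ENNReal.ofReal (1 - p)) (by
    simp [← ENNReal.ofReal_add h0 (sub_nonneg.2 h1)])

variable (Γ : ExpGame)

/-- `g = λ m - c`, the expected payoff of the risky arm in the good state. -/
def g : ℝ := Γ.lam * Γ.m - Γ.c

/-- Belief after a failed experiment, starting from belief `p`. -/
noncomputable def φ (p : ℝ) : ℝ := p * (1 - Γ.lam) / (p * (1 - Γ.lam) + 1 - p)

/-- The one-player cut-off `p*`. -/
noncomputable def pStar : ℝ :=
  Γ.c * (1 - Γ.δ) / (Γ.c * (1 - Γ.δ) + Γ.g * (1 - Γ.δ * (1 - Γ.lam)))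

/-- The encouragement cut-off. -/
noncomputable def pHat : ℝ :=
  Γ.c * (1 - Γ.δ) /
    (Γ.c * (1 - Γ.δ) + Γ.g * (1 - Γ.δ + Γ.lam * Γ.δ * (1 + Γ.δ - Γ.lam * Γ.δ)))

/-- Distribution of the move (with outcome) when arm `a` is chosen in state `θ`. -/
noncomputable def outcome : State → Arm → PMF Move
  | _, .S => PMF.pure .safe
  | .B, .R => PMF.pure (.risky false)
  | .G, .R => (coin Γ.lam Γ.lam_pos.le Γ.lam_lt_one.le).map .risky

/-- Distribution of the full history one move after `x`, when players use `σ`. -/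
noncomputable def step (σ : Profile) (x : FullHist) : PMF FullHist :=
  (σ (active x.moves.length) (view (active x.moves.length) x.moves)).bind fun a =>
    (Γ.outcome x.state a).map fun y => ⟨x.state, y :: x.moves⟩

/-- Distribution of the full history `n` moves later, if the current one has distribution `μ`. -/
noncomputable def evolve (σ : Profile) (μ : PMF FullHist) : ℕ → PMF FullHist
  | 0 => μ
  | n + 1 => (evolve σ μ n).bind (Γ.step σ)

/-- Distribution of the initial full history: only the state is drawn. -/
noncomputable def init : PMF FullHist :=
  (coin Γ.p0 Γ.p0_pos.le Γ.p0_lt_one.le).map fun b => ⟨if b then .G else .B, []⟩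

/-- The one-move transition kernel on full histories. -/
noncomputable def stepKernel (σ : Profile) : Kernel FullHist FullHist :=
  ⟨fun x => (Γ.step σ x).toMeasure, Measurable.of_discrete⟩

instance (σ : Profile) : IsMarkovKernel (Γ.stepKernel σ) :=
  ⟨fun x => inferInstanceAs (IsProbabilityMeasure (Γ.step σ x).toMeasure)⟩

/-- The law `P_σ` of the infinite play; the `n`-th coordinate is the full history after `n` moves. -/
noncomputable def playLaw (σ : Profile) : Measure (ℕ → FullHist) :=
  Kernel.trajMeasure (X := fun _ => FullHist) Γ.init.toMeasure fun n =>
    (Γ.stepKernel σ).comap (fun z : Finset.Iic n → FullHist => z ⟨n, by simp⟩)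
      (measurable_pi_apply _)

/-- Bayesian posterior probability of the full history `y` for player `i` at private history `v`,
when players use `τ`. -/
noncomputable def posterior (τ : Profile) (i : Player) (v : PrivHist) (y : FullHist) : ENNReal :=
  ((Γ.evolve τ Γ.init v.length).toMeasure[|{x | view i x.moves = v}]) {y}

/-- Every arm is chosen with positive probability at every private history. -/
def CompletelyMixed (τ : Profile) : Prop := ∀ i v a, τ i v a ≠ 0

/-- Consistency of beliefs with a profile: the pair is a (pointwise) limit of completely mixed
profiles and of the beliefs they induce by Bayes' rule. -/
def Consistent (σ : Profile) (π : Beliefs) : Prop :=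
  ∃ τ : ℕ → Profile, (∀ n, CompletelyMixed (τ n)) ∧
    (∀ i v a, Tendsto (fun n => τ n i v a) atTop (𝓝 (σ i v a))) ∧
    ∀ (i : Player) (h : List Move) (y : FullHist),
      Tendsto (fun n => Γ.posterior (τ n) i (view i h) y) atTop (𝓝 (π i (view i h) y))

/-- Realized payoff of a move to the player who makes it. -/
def payoff : Move → ℝ
  | .safe => 0
  | .risky s => (if s then Γ.m else 0) - Γ.c

/-- Realized payoff of the most recent move. -/
def lastPayoff (x : FullHist) : ℝ :=
  match x.moves with
  | [] => 0
  | y :: _ => Γ.payoff y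

/-- Normalized expected discounted continuation payoff of the player who is active at the current
full history, when the latter has distribution `μ` and players use `σ` from now on. That player
makes the moves number `1, 3, 5, …` from now on, one in each period. -/
noncomputable def contPayoff (σ : Profile) (μ : PMF FullHist) : ℝ :=
  (1 - Γ.δ) * ∑' k : ℕ, Γ.δ ^ k * ∫ x, Γ.lastPayoff x ∂(Γ.evolve σ μ (2 * k + 1)).toMeasure

/-- Sequential rationality: at each private history where he is active, the strategy of a player is
a best reply given his beliefs. -/
def SequentiallyRational (σ : Profile) (π : Beliefs) : Prop :=
  ∀ (i : Player) (h : List Move), active h.length = i → ∀ τ : Strategy,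
    Γ.contPayoff (Function.update σ i τ) (π i (view i h)) ≤ Γ.contPayoff σ (π i (view i h))

/-- Sequential equilibrium. -/
def IsSequentialEquilibrium (σ : Profile) (π : Beliefs) : Prop :=
  Γ.SequentiallyRational σ π ∧ Γ.Consistent σ π

/-- First-order belief (probability of the good state) of player `i` at private history `v`. -/
noncomputable def belief (π : Beliefs) (i : Player) (v : PrivHist) : ℝ :=
  ((π i v).toMeasure {x | x.state = State.G}).toReal

/-- `p^i(h)`: first-order belief of player `i` when the public history is `h` and `i` was not
successful. -/
noncomputable def pubBelief (π : Beliefs) (i : Player) (h : List Arm) : ℝ :=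
  belief π i (failView i h)

/-- Number of experiments along a public history. -/
def numExp (h : List Arm) : ℕ := h.count Arm.R

/-- Reasonable beliefs. A choice of `S` by the other player reveals that his past experiments
failed, and if he then chooses `R` in the next period, this choice is uninformative. -/
def Reasonable (π : Beliefs) : Prop :=
  ∀ h : List Arm,
    pubBelief π (active (Arm.S :: h).length) (Arm.S :: h) = Γ.φ^[numExp h] Γ.p0 ∧
    ∀ a : Arm, pubBelief π (active (Arm.R :: a :: Arm.S :: h).length) (Arm.R :: a :: Arm.S :: h) =
      Γ.φ^[numExp (a :: Arm.S :: h)] Γ.p0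

/-- `ℓ` is the final belief of player `i` along the infinite play `ω`. -/
def IsFinalBelief (π : Beliefs) (i : Player) (ω : ℕ → FullHist) (ℓ : ℝ) : Prop :=
  Tendsto (fun n => belief π i (view i (ω n).moves)) atTop (𝓝 ℓ)

end ExpGame

/-!
A player who chooses `S` reveals that all his experiments failed: a player who had a success is sure
that the state is good and experiments forever. After `S` beliefs are therefore common, and the
value of an experiment is governed by the odds of the good state. An upper bound for the players'
payoffs, improved by the factor `δ` in each round, shows that nobody experiments after an `S` below
`p̂`; below `p̂` even a player whose opponent may hide a success prefers to choose `S` and to see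
whether the opponent goes on.

In the bad state all experiments fail, so with positive probability play follows a public history at
which failing players stop for good. They cannot experiment forever with probability one, since a
player who only sees failures becomes pessimistic. They cannot stop after `[]` if `p0 > p*`, since a
single experiment pays. They cannot stop above `p̂` either: after a last `R` followed by `S`,
further experiments would convince the opponent of a past success and make him experiment in turn,
and that encouragement makes them profitable exactly above `p̂`.
-/

section Integral

variable {α β : Type*} [MeasurableSpace α] [DiscreteMeasurableSpace α]
  [MeasurableSpace β]

theorem integrable_of_abs_le (μ : Measure α) [IsFiniteMeasure μ] {f : α → ℝ} {C : ℝ}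
    (hf : ∀ a, |f a| ≤ C) : Integrable f μ :=
  .of_bound Measurable.of_discrete.aestronglyMeasurable C (ae_of_all _ hf)

theorem ae_toMeasure_of_forall_ne_zero (p : PMF α) {P : α → Prop} (h : ∀ a, p a ≠ 0 → P a) :
    ∀ᵐ a ∂p.toMeasure, P a := by
  rw [ae_iff, p.toMeasure_apply_eq_zero_iff .of_discrete, Set.disjoint_left]
  exact fun a ha hna => hna (h a ha)

theorem integral_toMeasure_congr (p : PMF α) {f g : α → ℝ} (h : ∀ a, p a ≠ 0 → f a = g a) :
    ∫ a, f a ∂p.toMeasure = ∫ a, g a ∂p.toMeasure :=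
  integral_congr_ae (ae_toMeasure_of_forall_ne_zero p h)

theorem toMeasure_bind [Countable α] (p : PMF α) (q : α → PMF β) :
    (p.bind q).toMeasure = p.toMeasure.bind fun a => (q a).toMeasure := by
  ext s hs
  rw [PMF.toMeasure_bind_apply p q s hs, Measure.bind_apply hs Measurable.of_discrete.aemeasurable,
    lintegral_countable']
  refine tsum_congr fun a => ?_
  rw [PMF.toMeasure_apply_singleton _ _ .of_discrete, mul_comm]

theorem integral_toMeasure_bind [Countable α] (p : PMF α) (q : α → PMF β) {f : β → ℝ}
    (hf : Integrable f (p.bind q).toMeasure) :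
    ∫ b, f b ∂(p.bind q).toMeasure = ∫ a, ∫ b, f b ∂(q a).toMeasure ∂p.toMeasure := by
  let κ : Kernel α β := ⟨fun a => (q a).toMeasure, .of_discrete⟩
  have hκ : (p.bind q).toMeasure = (κ ∘ₖ Kernel.const Unit p.toMeasure) () := by
    rw [Kernel.comp_apply, Kernel.const_apply, toMeasure_bind]
    rfl
  rw [hκ] at hf ⊢
  exact Kernel.integral_comp hf

theorem integral_toMeasure_map [DiscreteMeasurableSpace β] (p : PMF α) (g : α → β) (f : β → ℝ) :
    ∫ b, f b ∂(p.map g).toMeasure = ∫ a, f (g a) ∂p.toMeasure := by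
  rw [← PMF.toMeasure_map g p Measurable.of_discrete]
  exact integral_map Measurable.of_discrete.aemeasurable Measurable.of_discrete.aestronglyMeasurable

theorem integral_toMeasure_pure (a : α) (f : α → ℝ) :
    ∫ b, f b ∂(PMF.pure a).toMeasure = f a := by
  rw [PMF.toMeasure_pure, integral_dirac]

theorem integral_toMeasure_le_of_pair (p : PMF α) {f : α → ℝ} (hf : Integrable f p.toMeasure)
    {a b : α} (hab : a ≠ b) {k : ℝ} (hk : ∀ x, p x ≠ 0 → x ≠ a → x ≠ b → f x ≤ k) :
    ∫ x, f x ∂p.toMeasure ≤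
      (p a).toReal * f a + (p b).toReal * f b + (1 - (p a).toReal - (p b).toReal) * k := by
  classical
  have integrable_single (c : α) (r : ℝ) : Integrable (Set.indicator {c} fun _ => r) p.toMeasure :=
    (integrable_const r).indicator .of_discrete
  have integral_single (c : α) (r : ℝ) :
      ∫ x, Set.indicator {c} (fun _ => r) x ∂p.toMeasure = (p c).toReal * r := by
    rw [integral_indicator_const _ .of_discrete, measureReal_def,
      p.toMeasure_apply_singleton _ .of_discrete, smul_eq_mul]
  have f_le : ∀ᵐ x ∂p.toMeasure, f x ≤
      k + (Set.indicator {a} (fun _ => f a - k) x + Set.indicator {b} (fun _ => f b - k) x) := by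
    refine ae_toMeasure_of_forall_ne_zero p fun x hx => ?_
    obtain rfl | hxa := eq_or_ne x a
    · simp [hab]
    obtain rfl | hxb := eq_or_ne x b
    · simp [hxa]
    simpa [hxa, hxb] using hk x hx hxa hxb
  calc
    _ ≤ _ := integral_mono_ae hf
      ((integrable_const k).add ((integrable_single a _).add (integrable_single b _))) f_le
    _ = k + ((p a).toReal * (f a - k) + (p b).toReal * (f b - k)) := by
      rw [integral_add' (integrable_const k) ((integrable_single a _).add (integrable_single b _)),
        integral_add' (integrable_single a _) (integrable_single b _), integral_single,
        integral_single]
      simp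
    _ = _ := by ring

theorem toMeasure_bind_le [DiscreteMeasurableSpace β] (p : PMF α) {f : α → PMF β} {s : Set α}
    {t : Set β} {κ : ENNReal} (hle : ∀ a ∈ s, (f a).toMeasure t ≤ κ)
    (hzero : ∀ a ∉ s, (f a).toMeasure t = 0) :
    (p.bind f).toMeasure t ≤ κ * p.toMeasure s := by
  rw [PMF.toMeasure_bind_apply _ _ _ .of_discrete, PMF.toMeasure_apply _ .of_discrete,
    ← ENNReal.tsum_mul_left]
  refine ENNReal.tsum_le_tsum fun a => ?_
  by_cases ha : a ∈ s
  · rw [Set.indicator_of_mem ha, mul_comm]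
    gcongr
    exact hle a ha
  · rw [hzero a ha, mul_zero]
    exact zero_le

end Integral

section Discounting

variable {r C : ℝ}

theorem abs_pow_mul_le (hr : 0 ≤ r) {x : ℝ} (hx : |x| ≤ C) (k : ℕ) : |r ^ k * x| ≤ r ^ k * C := by
  rw [abs_mul, abs_of_nonneg (pow_nonneg hr k)]
  exact mul_le_mul_of_nonneg_left hx (pow_nonneg hr k)

theorem summable_pow_mul_of_abs_le (hr : 0 ≤ r) (hr' : r < 1) {u : ℕ → ℝ}
    (hu : ∀ k, |u k| ≤ C) : Summable fun k => r ^ k * u k :=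
  .of_norm_bounded ((summable_geometric_of_lt_one hr hr').mul_right C)
    fun k => abs_pow_mul_le hr (hu k) k

theorem abs_one_sub_mul_tsum_pow_mul_le (hr : 0 ≤ r) (hr' : r < 1) {u : ℕ → ℝ}
    (hu : ∀ k, |u k| ≤ C) : |(1 - r) * ∑' k, r ^ k * u k| ≤ C := by
  have hr1 : 0 < 1 - r := sub_pos.2 hr'
  have tsum_le : |∑' k, r ^ k * u k| ≤ (1 - r)⁻¹ * C :=
    tsum_of_norm_bounded (E := ℝ) ((hasSum_geometric_of_lt_one hr hr').mul_right C)
      fun k => abs_pow_mul_le hr (hu k) k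
  calc
    _ = (1 - r) * |∑' k, r ^ k * u k| := by rw [abs_mul, abs_of_pos hr1]
    _ ≤ (1 - r) * ((1 - r)⁻¹ * C) := mul_le_mul_of_nonneg_left tsum_le hr1.le
    _ = C := by rw [← mul_assoc, mul_inv_cancel₀ hr1.ne', one_mul]

theorem integral_tsum_pow_mul {α : Type*} [MeasurableSpace α] [DiscreteMeasurableSpace α]
    (μ : Measure α) [IsFiniteMeasure μ] (hr : 0 ≤ r) (hr' : r < 1) {F : ℕ → α → ℝ}
    (hF : ∀ k a, |F k a| ≤ C) :
    ∫ a, ∑' k, r ^ k * F k a ∂μ = ∑' k, r ^ k * ∫ a, F k a ∂μ := by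
  have abs_le (k : ℕ) (a : α) : |r ^ k * F k a| ≤ r ^ k * C := abs_pow_mul_le hr (hF k a) k
  simp only [← integral_const_mul]
  refine (integral_tsum_of_summable_integral_norm
    (fun k => integrable_of_abs_le μ (abs_le k)) ?_).symm
  refine .of_nonneg_of_le (fun k => integral_nonneg fun a => norm_nonneg _) (fun k => ?_)
    ((summable_geometric_of_lt_one hr hr').mul_right (C * μ.real Set.univ))
  calc
    _ ≤ ∫ _, r ^ k * C ∂μ := integral_mono (integrable_of_abs_le μ (abs_le k)).norm
      (integrable_const _) (abs_le k)
    _ = r ^ k * (C * μ.real Set.univ) := by rw [integral_const, smul_eq_mul]; ring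

theorem nonpos_of_forall_le_imp_le_mul {ι : Type*} {P : ι → Prop} {f : ι → ℝ} {M : ℝ}
    (hr : 0 ≤ r) (hr' : r < 1) (hM : ∀ x, P x → f x ≤ M)
    (h : ∀ D, 0 ≤ D → (∀ x, P x → f x ≤ D) → ∀ x, P x → f x ≤ r * D) {x : ι} (hx : P x) :
    f x ≤ 0 := by
  have le_pow (n : ℕ) : ∀ x, P x → f x ≤ r ^ n * max M 0 := by
    induction n with
    | zero => exact fun x hx => by simpa using Or.inl (hM x hx)
    | succ n ih =>
      rw [pow_succ', mul_assoc]
      exact h _ (by positivity) ih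
  have tendsto_zero : Tendsto (fun n : ℕ => r ^ n * max M 0) atTop (𝓝 0) := by
    simpa using (tendsto_pow_atTop_nhds_zero_of_lt_one hr hr').mul_const (max M 0)
  exact ge_of_tendsto' tendsto_zero fun n => le_pow n x hx

end Discounting

namespace ExpGame

/-! ### Histories and private histories -/

theorem active_succ_ne (n : ℕ) : active (n + 1) ≠ active n := by
  by_cases h : Even n <;> simp [active, Nat.even_add_one, h]

@[simp] theorem active_add_two (n : ℕ) : active (n + 1 + 1) = active n := by
  simp [active, Nat.even_add_one]

theorem eq_active_succ_of_ne {n : ℕ} {i : Player} (h : i ≠ active n) : i = active (n + 1) := by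
  have := active_succ_ne n
  revert h this
  generalize active n = a
  generalize active (n + 1) = b
  revert i a b
  decide

theorem map_arm_view (i : Player) (m : List Move) :
    (view i m).map (Sum.elim Move.arm id) = m.map Move.arm := by
  induction m with
  | nil => rfl
  | cons x m ih => rw [view]; split_ifs <;> simp [ih]

theorem map_arm_eq_of_view_eq {i : Player} {m m' : List Move} (h : view i m = view i m') :
    m.map Move.arm = m'.map Move.arm := by
  rw [← map_arm_view i, h, map_arm_view]

@[simp] theorem length_view (i : Player) (m : List Move) : (view i m).length = m.length := by
  simpa using congrArg List.length (map_arm_view i m)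

theorem length_eq_of_view_eq {i : Player} {m m' : List Move} (h : view i m = view i m') :
    m.length = m'.length := by
  simpa using congrArg List.length h

theorem view_cons_own {i : Player} {m : List Move} (h : active m.length = i) (x : Move) :
    view i (x :: m) = Sum.inl x :: view i m := by simp [view, h]

theorem view_cons_other {i : Player} {m : List Move} (h : active m.length ≠ i) (x : Move) :
    view i (x :: m) = Sum.inr x.arm :: view i m := by simp [view, h]

theorem view_cons_congr {i : Player} {m m' : List Move} (h : view i m = view i m') (x : Move) :
    view i (x :: m) = view i (x :: m') := by
  rw [view, view, length_eq_of_view_eq h, h]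

@[simp] theorem arm_failed (a : Arm) : a.failed.arm = a := by cases a <;> rfl

@[simp] theorem map_arm_map_failed (h : List Arm) : (h.map Arm.failed).map Move.arm = h := by
  rw [List.map_map]
  exact List.map_id'' arm_failed h

theorem risky_true_notMem_map_failed (h : List Arm) : Move.risky true ∉ h.map Arm.failed := by
  simp only [List.mem_map, not_exists, not_and]
  rintro (_ | _) _ <;> simp [Arm.failed]

theorem map_failed_map_arm {m : List Move} (hm : Move.risky true ∉ m) :
    (m.map Move.arm).map Arm.failed = m := by
  induction m with
  | nil => rfl
  | cons x m ih =>
    simp only [List.mem_cons, not_or] at hm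
    rw [List.map_cons, List.map_cons, ih hm.2]
    obtain _ | _ | _ := x
    exacts [rfl, rfl, (hm.1 rfl).elim]

/-- Player `i` had a successful experiment in the course of the moves `m`. -/
def Successful (i : Player) (m : List Move) : Prop := Sum.inl (Move.risky true) ∈ view i m

theorem Successful.cons {i : Player} {m : List Move} (h : Successful i m) (x : Move) :
    Successful i (x :: m) :=
  List.mem_cons_of_mem _ h

theorem Successful.risky_true_mem {i : Player} {m : List Move} (h : Successful i m) :
    Move.risky true ∈ m := by
  induction m with
  | nil => simp [Successful, view] at h
  | cons x m ih =>
    rw [Successful, view, List.mem_cons] at h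
    obtain h | h := h
    · split_ifs at h
      simp only [Sum.inl.injEq] at h
      simp [h]
    · exact List.mem_cons_of_mem _ (ih h)

theorem exists_successful {m : List Move} (h : Move.risky true ∈ m) : ∃ i, Successful i m := by
  induction m with
  | nil => simp at h
  | cons x m ih =>
    obtain rfl | h := List.mem_cons.1 h
    · exact ⟨active m.length, by simp [Successful, view]⟩
    · obtain ⟨i, hi⟩ := ih h
      exact ⟨i, hi.cons x⟩

theorem not_successful_map_failed (i : Player) (h : List Arm) :
    ¬ Successful i (h.map Arm.failed) :=
  fun hs => risky_true_notMem_map_failed h hs.risky_true_mem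

theorem eq_map_failed_or_successful_of_view_eq_failView {i : Player} {m : List Move}
    {h : List Arm} (hv : view i m = failView i h) :
    m = h.map Arm.failed ∨ ∃ j, j ≠ i ∧ Successful j m := by
  by_cases hm : Move.risky true ∈ m
  · obtain ⟨j, hj⟩ := exists_successful hm
    refine .inr ⟨j, ?_, hj⟩
    rintro rfl
    rw [Successful, hv] at hj
    exact not_successful_map_failed _ h hj
  · left
    rw [← map_failed_map_arm hm, map_arm_eq_of_view_eq hv, map_arm_map_failed]

section Value

variable (Γ : ExpGame)

/-! ### Continuation values -/

instance : MeasurableSpace Arm := ⊤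

instance : DiscreteMeasurableSpace Arm := ⟨fun _ => trivial⟩

instance : Fintype Arm := ⟨{.S, .R}, fun a => by cases a <;> simp⟩

instance : Countable FullHist := by
  have : Countable Move := Function.Injective.countable
    (f := fun x => match x with | .safe => none | .risky s => some s)
    (by rintro (_ | _) (_ | _) <;> simp)
  have : Countable State := Function.Injective.countable (f := fun θ => decide (θ = .G))
    (by rintro (_ | _) (_ | _) <;> simp)
  exact Function.Injective.countable (f := fun x => (x.state, x.moves))
    (by rintro ⟨_, _⟩ ⟨_, _⟩; simp)

theorem sum_arm {M : Type*} [AddCommMonoid M] (f : Arm → M) : ∑ a, f a = f .S + f .R := by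
  rw [show (Finset.univ : Finset Arm) = {.S, .R} from rfl, Finset.sum_pair (by simp)]

theorem toReal_safe (p : PMF Arm) : (p .S).toReal = 1 - (p .R).toReal := by
  have h : ∫ _, (1 : ℝ) ∂p.toMeasure = 1 := by simp
  rw [PMF.integral_eq_sum, sum_arm] at h
  simp only [smul_eq_mul, mul_one] at h
  linarith

/-- Probability that the player who is active after the moves `m` experiments. -/
noncomputable def riskProb (σ : Profile) (m : List Move) : ℝ :=
  (σ (active m.length) (view (active m.length) m) Arm.R).toReal

theorem riskProb_nonneg (σ : Profile) (m : List Move) : 0 ≤ riskProb σ m := ENNReal.toReal_nonneg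

theorem riskProb_le_one (σ : Profile) (m : List Move) : riskProb σ m ≤ 1 := by
  rw [riskProb, ← sub_nonneg, ← toReal_safe]
  exact ENNReal.toReal_nonneg

theorem riskProb_congr {σ : Profile} {m m' : List Move}
    (h : view (active m.length) m = view (active m.length) m') : riskProb σ m = riskProb σ m' := by
  rw [riskProb, riskProb, h, length_eq_of_view_eq h]

/-- Expectation of `f` over the outcome of an experiment in a given state. -/
def outcomeMean : State → (Move → ℝ) → ℝ
  | .G, f => Γ.lam * f (.risky true) + (1 - Γ.lam) * f (.risky false)
  | .B, f => f (.risky false)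

/-- Expectation of `f` over the full history one move after `x`, when players use `σ`. -/
noncomputable def nextMean (σ : Profile) (f : FullHist → ℝ) (x : FullHist) : ℝ :=
  (1 - riskProb σ x.moves) * f ⟨x.state, .safe :: x.moves⟩
    + riskProb σ x.moves * Γ.outcomeMean x.state fun y => f ⟨x.state, y :: x.moves⟩

theorem integral_coin (p : ℝ) (h0 : 0 ≤ p) (h1 : p ≤ 1) (f : Bool → ℝ) :
    ∫ b, f b ∂(coin p h0 h1).toMeasure = p * f true + (1 - p) * f false := by
  rw [PMF.integral_eq_sum, Fintype.sum_bool]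
  simp [coin, PMF.ofFintype_apply, ENNReal.toReal_ofReal, h0, h1]

theorem integral_step (σ : Profile) {f : FullHist → ℝ} {C : ℝ} (hf : ∀ x, |f x| ≤ C)
    (x : FullHist) : ∫ y, f y ∂(Γ.step σ x).toMeasure = Γ.nextMean σ f x := by
  obtain ⟨θ, m⟩ := x
  rw [step, integral_toMeasure_bind _ _ (integrable_of_abs_le _ hf), PMF.integral_eq_sum, sum_arm,
    toReal_safe]
  cases θ <;>
    simp only [outcome, PMF.pure_map, PMF.map_comp, integral_toMeasure_pure,
      integral_toMeasure_map, integral_coin, smul_eq_mul, Function.comp_apply, nextMean,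
      outcomeMean, riskProb]

section Bounds

variable {Γ} {σ : Profile} {f : FullHist → ℝ} {x : FullHist} {C : ℝ}

theorem outcomeMean_mem {s : Set ℝ} (hs : Convex ℝ s) {θ : State} {f : Move → ℝ}
    (hf : ∀ b, f (.risky b) ∈ s) : Γ.outcomeMean θ f ∈ s := by
  cases θ
  · exact hs (hf true) (hf false) Γ.lam_pos.le (sub_nonneg.2 Γ.lam_lt_one.le)
      (add_sub_cancel _ _)
  · exact hf false

theorem nextMean_mem {s : Set ℝ} (hs : Convex ℝ s)
    (hf : ∀ y, f ⟨x.state, y :: x.moves⟩ ∈ s) : Γ.nextMean σ f x ∈ s :=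
  hs (hf .safe) (outcomeMean_mem hs fun _ => hf _) (sub_nonneg.2 (riskProb_le_one _ _))
    (riskProb_nonneg _ _) (sub_add_cancel _ _)

theorem nextMean_le (hf : ∀ y, f ⟨x.state, y :: x.moves⟩ ≤ C) : Γ.nextMean σ f x ≤ C :=
  nextMean_mem (convex_Iic C) hf

theorem le_nextMean (hf : ∀ y, C ≤ f ⟨x.state, y :: x.moves⟩) : C ≤ Γ.nextMean σ f x :=
  nextMean_mem (convex_Ici C) hf

theorem abs_nextMean_le (hf : ∀ x, |f x| ≤ C) (x : FullHist) : |Γ.nextMean σ f x| ≤ C :=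
  abs_le.2 (nextMean_mem (convex_Icc (-C) C) fun _ => abs_le.1 (hf _))

theorem abs_iterate_nextMean_le (hf : ∀ x, |f x| ≤ C) (n : ℕ) (x : FullHist) :
    |(Γ.nextMean σ)^[n] f x| ≤ C := by
  induction n generalizing f with
  | zero => exact hf x
  | succ _ ih => exact ih (abs_nextMean_le hf)

end Bounds

theorem integral_evolve (σ : Profile) {f : FullHist → ℝ} {C : ℝ} (hf : ∀ x, |f x| ≤ C)
    (μ : PMF FullHist) (n : ℕ) :
    ∫ y, f y ∂(Γ.evolve σ μ n).toMeasure = ∫ x, (Γ.nextMean σ)^[n] f x ∂μ.toMeasure := by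
  induction n generalizing f with
  | zero => rfl
  | succ n ih =>
    rw [evolve, integral_toMeasure_bind _ _ (integrable_of_abs_le _ hf)]
    simp only [Γ.integral_step σ hf]
    exact ih (abs_nextMean_le hf)

/-- Expected flow payoff of an experiment. -/
def gain : State → ℝ
  | .G => Γ.g
  | .B => -Γ.c

/-- A common bound for flow payoffs, hence for normalized discounted payoffs. -/
noncomputable def payBound : ℝ := |Γ.m| + Γ.c

theorem abs_lastPayoff_le (x : FullHist) : |Γ.lastPayoff x| ≤ Γ.payBound := by
  have hc := Γ.c_pos
  have hm := abs_nonneg Γ.m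
  obtain ⟨θ, _ | ⟨_ | _ | _, m⟩⟩ := x <;>
    simp only [lastPayoff, payoff, payBound, Bool.false_eq_true, if_true, if_false, zero_sub,
      abs_neg, abs_zero]
  · positivity
  · positivity
  · rw [abs_of_pos hc]; linarith
  · exact (abs_sub _ _).trans_eq (by rw [abs_of_pos hc])

theorem nextMean_lastPayoff (σ : Profile) (x : FullHist) :
    Γ.nextMean σ Γ.lastPayoff x = riskProb σ x.moves * Γ.gain x.state := by
  obtain ⟨θ, m⟩ := x
  cases θ <;>
    simp only [nextMean, lastPayoff, payoff, outcomeMean, gain, g, if_true, Bool.false_eq_true,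
      if_false] <;> ring

theorem abs_gain_le (θ : State) : |Γ.gain θ| ≤ Γ.payBound := by
  have mean_payoff : Γ.gain θ = Γ.outcomeMean θ fun y => Γ.lastPayoff ⟨θ, [y]⟩ := by
    cases θ <;> simp only [gain, g, outcomeMean, lastPayoff, payoff, if_true, Bool.false_eq_true,
      if_false] <;> ring
  rw [mean_payoff]
  exact abs_le.2 (outcomeMean_mem (convex_Icc _ _) fun _ => abs_le.1 (Γ.abs_lastPayoff_le _))

/-- Normalized expected discounted continuation payoff, at the full history `x`, of the player who
is active there, when players use `σ`. -/
noncomputable def value (σ : Profile) (x : FullHist) : ℝ :=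
  (1 - Γ.δ) * ∑' k : ℕ, Γ.δ ^ k * (Γ.nextMean σ)^[2 * k + 1] Γ.lastPayoff x

theorem abs_value_le (σ : Profile) (x : FullHist) : |Γ.value σ x| ≤ Γ.payBound :=
  abs_one_sub_mul_tsum_pow_mul_le Γ.δ_pos.le Γ.δ_lt_one fun _ =>
    abs_iterate_nextMean_le Γ.abs_lastPayoff_le _ _

theorem contPayoff_eq_integral_value (σ : Profile) (μ : PMF FullHist) :
    Γ.contPayoff σ μ = ∫ x, Γ.value σ x ∂μ.toMeasure := by
  simp only [contPayoff, value, integral_const_mul, Γ.integral_evolve σ Γ.abs_lastPayoff_le]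
  rw [integral_tsum_pow_mul _ Γ.δ_pos.le Γ.δ_lt_one fun _ =>
    abs_iterate_nextMean_le Γ.abs_lastPayoff_le _]

theorem nextMean_discounted (σ : Profile) {F : ℕ → FullHist → ℝ} {C : ℝ}
    (hF : ∀ k x, |F k x| ≤ C) :
    Γ.nextMean σ (fun y => (1 - Γ.δ) * ∑' k, Γ.δ ^ k * F k y)
      = fun x => (1 - Γ.δ) * ∑' k, Γ.δ ^ k * Γ.nextMean σ (F k) x := by
  funext x
  rw [← Γ.integral_step σ fun _ =>
    abs_one_sub_mul_tsum_pow_mul_le Γ.δ_pos.le Γ.δ_lt_one fun k => hF k _]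
  simp only [← Γ.integral_step σ (hF _), integral_const_mul]
  rw [integral_tsum_pow_mul _ Γ.δ_pos.le Γ.δ_lt_one hF]

theorem value_eq_gain_add (σ : Profile) (x : FullHist) :
    Γ.value σ x = (1 - Γ.δ) * (riskProb σ x.moves * Γ.gain x.state)
      + Γ.δ * Γ.nextMean σ (Γ.nextMean σ (Γ.value σ)) x := by
  have abs_le (n : ℕ) (x : FullHist) : |(Γ.nextMean σ)^[n] Γ.lastPayoff x| ≤ Γ.payBound :=
    abs_iterate_nextMean_le Γ.abs_lastPayoff_le n x
  have next_next_value : Γ.nextMean σ (Γ.nextMean σ (Γ.value σ)) x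
      = (1 - Γ.δ) * ∑' k : ℕ, Γ.δ ^ k * (Γ.nextMean σ)^[2 * k + 3] Γ.lastPayoff x := by
    rw [show Γ.value σ = fun x => _ from rfl]
    simp only [value, Γ.nextMean_discounted σ fun k => abs_le (2 * k + 1),
      ← Function.iterate_succ_apply' (Γ.nextMean σ),
      Γ.nextMean_discounted σ fun k => abs_le (2 * k + 1).succ]
  rw [next_next_value, value,
    (summable_pow_mul_of_abs_le Γ.δ_pos.le Γ.δ_lt_one fun k => abs_le _ x).tsum_eq_zero_add,
    ← Γ.nextMean_lastPayoff σ x, mul_add]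
  simp only [pow_zero, one_mul, mul_zero, zero_add, Function.iterate_one, pow_succ',
    mul_assoc, tsum_mul_left, mul_left_comm (1 - Γ.δ) Γ.δ]
  rfl

/-- Continuation value of the active player at `x` if he chooses arm `a` there, and players use
`σ` afterwards. -/
noncomputable def armValue (σ : Profile) (x : FullHist) : Arm → ℝ
  | .S => Γ.δ * Γ.nextMean σ (Γ.value σ) ⟨x.state, .safe :: x.moves⟩
  | .R => (1 - Γ.δ) * Γ.gain x.state
      + Γ.δ * Γ.outcomeMean x.state fun y => Γ.nextMean σ (Γ.value σ) ⟨x.state, y :: x.moves⟩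

theorem value_eq_armValue (σ : Profile) (x : FullHist) :
    Γ.value σ x =
      (1 - riskProb σ x.moves) * Γ.armValue σ x .S + riskProb σ x.moves * Γ.armValue σ x .R := by
  rw [value_eq_gain_add, armValue, armValue, nextMean]
  ring

theorem abs_armValue_le (σ : Profile) (x : FullHist) (a : Arm) :
    |Γ.armValue σ x a| ≤ Γ.payBound := by
  have convex : Convex ℝ (Set.Icc (-Γ.payBound) Γ.payBound) := convex_Icc _ _
  have next_mem (z : FullHist) :
      Γ.nextMean σ (Γ.value σ) z ∈ Set.Icc (-Γ.payBound) Γ.payBound :=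
    abs_le.1 (abs_nextMean_le (Γ.abs_value_le σ) z)
  have zero_mem : (0 : ℝ) ∈ Set.Icc (-Γ.payBound) Γ.payBound :=
    abs_le.1 (abs_zero.trans_le ((abs_nonneg _).trans (Γ.abs_value_le σ x)))
  have mix {u v : ℝ} (hu : u ∈ Set.Icc (-Γ.payBound) Γ.payBound)
      (hv : v ∈ Set.Icc (-Γ.payBound) Γ.payBound) :
      |(1 - Γ.δ) * u + Γ.δ * v| ≤ Γ.payBound :=
    abs_le.2 (convex hu hv (sub_nonneg.2 Γ.δ_lt_one.le) Γ.δ_pos.le (sub_add_cancel _ _))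
  cases a
  · simpa [armValue] using mix zero_mem (next_mem ⟨x.state, .safe :: x.moves⟩)
  · exact mix (abs_le.1 (Γ.abs_gain_le _)) (outcomeMean_mem convex fun _ => next_mem _)

theorem value_le_max_gain (σ : Profile) (x : FullHist) : Γ.value σ x ≤ max (Γ.gain x.state) 0 := by
  rw [← sub_nonpos]
  refine nonpos_of_forall_le_imp_le_mul (P := fun _ => True)
    (f := fun x => Γ.value σ x - max (Γ.gain x.state) 0) (M := Γ.payBound) Γ.δ_pos.le Γ.δ_lt_one
    (fun x _ => (sub_le_self _ (le_max_right _ 0)).trans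
      ((le_abs_self _).trans (Γ.abs_value_le σ x))) (fun D _ h y _ => ?_) trivial
  have next_le : Γ.nextMean σ (Γ.nextMean σ (Γ.value σ)) y ≤ max (Γ.gain y.state) 0 + D :=
    nextMean_le fun z => nextMean_le fun z' =>
      sub_le_iff_le_add'.1 (h ⟨y.state, z' :: z :: y.moves⟩ trivial)
  have gain_le : riskProb σ y.moves * Γ.gain y.state ≤ max (Γ.gain y.state) 0 :=
    (mul_le_mul_of_nonneg_left (le_max_left _ 0) (riskProb_nonneg _ _)).trans
      (mul_le_of_le_one_left (le_max_right _ _) (riskProb_le_one _ _))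
  have h1 := mul_le_mul_of_nonneg_left gain_le (sub_nonneg.2 Γ.δ_lt_one.le)
  have h2 := mul_le_mul_of_nonneg_left next_le Γ.δ_pos.le
  rw [value_eq_gain_add]
  linarith

theorem zero_lt_g : 0 < Γ.g := Γ.g_pos

theorem value_good_le (σ : Profile) (m : List Move) : Γ.value σ ⟨.G, m⟩ ≤ Γ.g :=
  (Γ.value_le_max_gain σ ⟨.G, m⟩).trans_eq (max_eq_left Γ.zero_lt_g.le)

theorem value_bad_nonpos (σ : Profile) (m : List Move) : Γ.value σ ⟨.B, m⟩ ≤ 0 :=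
  (Γ.value_le_max_gain σ ⟨.B, m⟩).trans_eq (max_eq_right (neg_nonpos.2 Γ.c_pos.le))

theorem nextMean_value_good_le (σ : Profile) (m : List Move) :
    Γ.nextMean σ (Γ.value σ) ⟨.G, m⟩ ≤ Γ.g :=
  nextMean_le fun _ => Γ.value_good_le _ _

theorem nextMean_value_bad_nonpos (σ : Profile) (m : List Move) :
    Γ.nextMean σ (Γ.value σ) ⟨.B, m⟩ ≤ 0 :=
  nextMean_le fun _ => Γ.value_bad_nonpos _ _

theorem armValue_risky_good_le (σ : Profile) (m : List Move) :
    Γ.armValue σ ⟨.G, m⟩ .R ≤ Γ.g := by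
  have h : Γ.outcomeMean .G (fun y => Γ.nextMean σ (Γ.value σ) ⟨.G, y :: m⟩) ≤ Γ.g :=
    outcomeMean_mem (convex_Iic _) fun _ => Γ.nextMean_value_good_le _ _
  have := mul_le_mul_of_nonneg_left h Γ.δ_pos.le
  simp only [armValue, gain]
  linarith

theorem armValue_risky_bad_le (σ : Profile) (m : List Move) :
    Γ.armValue σ ⟨.B, m⟩ .R ≤ -((1 - Γ.δ) * Γ.c) := by
  have := mul_nonpos_of_nonneg_of_nonpos Γ.δ_pos.le
    (Γ.nextMean_value_bad_nonpos σ (.risky false :: m))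
  simp only [armValue, gain, outcomeMean]
  linarith

theorem armValue_safe_good_le (σ : Profile) (m : List Move) :
    Γ.armValue σ ⟨.G, m⟩ .S ≤ Γ.δ * Γ.g :=
  mul_le_mul_of_nonneg_left (Γ.nextMean_value_good_le _ _) Γ.δ_pos.le

theorem value_good_eq_of_forall_risky {σ : Profile} {P : List Move → Prop}
    (hP : ∀ m, P m → ∀ y z, P (z :: y :: m)) (hr : ∀ m, P m → riskProb σ m = 1)
    {m : List Move} (hm : P m) : Γ.value σ ⟨.G, m⟩ = Γ.g := by
  refine le_antisymm (Γ.value_good_le _ _) (sub_nonpos.1 ?_)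
  refine nonpos_of_forall_le_imp_le_mul (P := P) (f := fun m => Γ.g - Γ.value σ ⟨.G, m⟩)
    (M := Γ.g + Γ.payBound) Γ.δ_pos.le Γ.δ_lt_one (fun m _ => ?_) (fun D _ h y hy => ?_) hm
  · have := (abs_le.1 (Γ.abs_value_le σ ⟨.G, m⟩)).1
    linarith
  · have le_next : Γ.g - D ≤ Γ.nextMean σ (Γ.nextMean σ (Γ.value σ)) ⟨.G, y⟩ :=
      le_nextMean fun z => le_nextMean fun z' => sub_le_comm.1 (h (z' :: z :: y) (hP y hy z z'))
    have := mul_le_mul_of_nonneg_left le_next Γ.δ_pos.le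
    rw [value_eq_gain_add, hr y hy, gain]
    linarith

/-- The invariant `P` need only follow the branches that have positive probability. -/
theorem value_eq_zero_of_forall_safe {σ : Profile} {P : List Move → Prop} (θ : State)
    (hS : ∀ m, P m → riskProb σ m = 0 ∧ P (.safe :: .safe :: m))
    (hR : ∀ m, P m → riskProb σ (.safe :: m) ≠ 0 → ∀ s, P (.risky s :: .safe :: m))
    {m : List Move} (hm : P m) : Γ.value σ ⟨θ, m⟩ = 0 := by
  refine abs_nonpos_iff.1 (nonpos_of_forall_le_imp_le_mul (P := P)
    (f := fun m => |Γ.value σ ⟨θ, m⟩|) Γ.δ_pos.le Γ.δ_lt_one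
    (fun m _ => Γ.abs_value_le _ _) (fun D _ h y hy => ?_) hm)
  have value_mem (z : Move) (hz : P (z :: .safe :: y)) :
      Γ.value σ ⟨θ, z :: .safe :: y⟩ ∈ Set.Icc (-D) D := abs_le.1 (h _ hz)
  have next_le : |Γ.nextMean σ (Γ.value σ) ⟨θ, .safe :: y⟩| ≤ D := by
    by_cases h0 : riskProb σ (.safe :: y) = 0
    · simpa [nextMean, h0] using h _ (hS y hy).2
    · exact abs_le.2 (convex_Icc (-D) D (value_mem _ (hS y hy).2)
        (outcomeMean_mem (convex_Icc _ _) fun s => value_mem _ (hR y hy h0 s))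
        (sub_nonneg.2 (riskProb_le_one _ _)) (riskProb_nonneg _ _) (sub_add_cancel _ _))
  rw [value_eq_armValue, (hS y hy).1, armValue, sub_zero, one_mul, zero_mul, add_zero, abs_mul,
    abs_of_pos Γ.δ_pos]
  exact mul_le_mul_of_nonneg_left next_le Γ.δ_pos.le

end Value

/-! ### Sequential rationality -/

/-- Beliefs compatible with observation: a player attaches positive probability only to full
histories that he cannot distinguish from the actual one. -/
def Compatible (π : Beliefs) : Prop :=
  ∀ ⦃i : Player⦄ ⦃m : List Move⦄ ⦃y : FullHist⦄, π i (view i m) y ≠ 0 → view i y.moves = view i m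

theorem Compatible.active_eq {π : Beliefs} (hπ : Compatible π) {i : Player} {m : List Move}
    (hi : active m.length = i) {y : FullHist} (hy : π i (view i m) y ≠ 0) :
    active y.moves.length = i := by
  rw [length_eq_of_view_eq (hπ hy), hi]

section Locality

variable {Γ : ExpGame} {σ σ' : Profile}

theorem iterate_nextMean_congr {L : ℕ}
    (h : ∀ m : List Move, L ≤ m.length → riskProb σ m = riskProb σ' m) (n : ℕ)
    {f f' : FullHist → ℝ} (hf : ∀ x, L ≤ x.moves.length → f x = f' x) {x : FullHist}
    (hx : L ≤ x.moves.length) : (Γ.nextMean σ)^[n] f x = (Γ.nextMean σ')^[n] f' x := by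
  induction n generalizing f f' with
  | zero => exact hf x hx
  | succ _ ih =>
    refine ih fun x hx => ?_
    have next_eq (y : Move) : f ⟨x.state, y :: x.moves⟩ = f' ⟨x.state, y :: x.moves⟩ :=
      hf _ (hx.trans (Nat.le_succ _))
    simp only [nextMean, h _ hx, next_eq]

theorem value_congr {x : FullHist}
    (h : ∀ m : List Move, x.moves.length ≤ m.length → riskProb σ m = riskProb σ' m) :
    Γ.value σ x = Γ.value σ' x := by
  simp only [value, iterate_nextMean_congr h _ (fun _ _ => rfl) le_rfl]

theorem armValue_congr {x : FullHist}
    (h : ∀ m : List Move, x.moves.length < m.length → riskProb σ m = riskProb σ' m) (a : Arm) :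
    Γ.armValue σ x a = Γ.armValue σ' x a := by
  have next_eq (y : Move) : Γ.nextMean σ (Γ.value σ) ⟨x.state, y :: x.moves⟩
      = Γ.nextMean σ' (Γ.value σ') ⟨x.state, y :: x.moves⟩ :=
    iterate_nextMean_congr h 1 (fun z hz => value_congr fun m hm => h m (hz.trans hm)) le_rfl
  cases a <;> simp only [armValue, next_eq]

theorem riskProb_update_self {i : Player} {m : List Move} (h : active m.length = i)
    (τ : Strategy) : riskProb (Function.update σ i τ) m = (τ (view i m) .R).toReal := by
  subst h
  rw [riskProb, Function.update_self]

theorem riskProb_update_other {i : Player} {m : List Move} (h : active m.length ≠ i)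
    (τ : Strategy) : riskProb (Function.update σ i τ) m = riskProb σ m := by
  rw [riskProb, riskProb, Function.update_of_ne h]

end Locality

section SequentiallyRational

variable {Γ : ExpGame} {σ : Profile} {π : Beliefs} {i : Player} {m : List Move}

theorem integrable_armValue (μ : PMF FullHist) (a : Arm) :
    Integrable (fun x => Γ.armValue σ x a) μ.toMeasure :=
  integrable_of_abs_le _ fun x => Γ.abs_armValue_le σ x a

theorem integral_armValue_le_contPayoff (hSR : Γ.SequentiallyRational σ π) (hπ : Compatible π)
    (hi : active m.length = i) (a : Arm) :
    ∫ x, Γ.armValue σ x a ∂(π i (view i m)).toMeasure ≤ Γ.contPayoff σ (π i (view i m)) := by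
  classical
  set τ : Strategy := Function.update (σ i) (view i m) (PMF.pure a) with hτ
  refine le_trans (le_of_eq ?_) (hSR i m hi τ)
  rw [contPayoff_eq_integral_value]
  refine integral_toMeasure_congr _ fun x hx => ?_
  have armValue_eq (b : Arm) :
      Γ.armValue σ x b = Γ.armValue (Function.update σ i τ) x b := by
    refine armValue_congr (fun m' hm' => ?_) b
    by_cases hi' : active m'.length = i
    · have view_ne : view i m' ≠ view i m := fun h =>
        hm'.ne (length_eq_of_view_eq ((hπ hx).trans h.symm))
      rw [riskProb_update_self hi', hτ, Function.update_of_ne view_ne, riskProb, hi']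
    · rw [riskProb_update_other hi']
  rw [value_eq_armValue, riskProb_update_self (hπ.active_eq hi hx), hπ hx, hτ,
    Function.update_self, ← hτ, armValue_eq]
  cases a <;> simp

theorem contPayoff_eq_integral_armValue (hπ : Compatible π) (hi : active m.length = i) :
    Γ.contPayoff σ (π i (view i m)) =
      (1 - riskProb σ m) * ∫ x, Γ.armValue σ x .S ∂(π i (view i m)).toMeasure
        + riskProb σ m * ∫ x, Γ.armValue σ x .R ∂(π i (view i m)).toMeasure := by
  rw [contPayoff_eq_integral_value, ← integral_const_mul, ← integral_const_mul,
    ← integral_add ((integrable_armValue _ _).const_mul _) ((integrable_armValue _ _).const_mul _)]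
  refine integral_toMeasure_congr _ fun x hx => ?_
  have riskProb_eq : riskProb σ x.moves = riskProb σ m :=
    riskProb_congr (by rw [hπ.active_eq hi hx, hπ hx])
  rw [value_eq_armValue, riskProb_eq]

theorem contPayoff_le_of_riskProb_ne_zero (hSR : Γ.SequentiallyRational σ π) (hπ : Compatible π)
    (hi : active m.length = i) (hr : riskProb σ m ≠ 0) :
    Γ.contPayoff σ (π i (view i m)) ≤ ∫ x, Γ.armValue σ x .R ∂(π i (view i m)).toMeasure := by
  have safe_le := integral_armValue_le_contPayoff hSR hπ hi .S
  have mix := contPayoff_eq_integral_armValue (Γ := Γ) (σ := σ) hπ hi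
  have riskProb_pos := (riskProb_nonneg σ m).lt_of_ne' hr
  have := mul_le_mul_of_nonneg_left safe_le (sub_nonneg.2 (riskProb_le_one σ m))
  exact le_of_mul_le_mul_left (by linarith) riskProb_pos

theorem contPayoff_le_of_riskProb_ne_one (hSR : Γ.SequentiallyRational σ π) (hπ : Compatible π)
    (hi : active m.length = i) (hr : riskProb σ m ≠ 1) :
    Γ.contPayoff σ (π i (view i m)) ≤ ∫ x, Γ.armValue σ x .S ∂(π i (view i m)).toMeasure := by
  have risky_le := integral_armValue_le_contPayoff hSR hπ hi .R
  have mix := contPayoff_eq_integral_armValue (Γ := Γ) (σ := σ) hπ hi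
  have safeProb_pos := sub_pos.2 ((riskProb_le_one σ m).lt_of_ne hr)
  have := mul_le_mul_of_nonneg_left risky_le (riskProb_nonneg σ m)
  exact le_of_mul_le_mul_left (by linarith) safeProb_pos

theorem g_le_contPayoff_of_sure_good (hSR : Γ.SequentiallyRational σ π) (hπ : Compatible π)
    (hi : active m.length = i) (hG : ∀ y, π i (view i m) y ≠ 0 → y.state = .G) :
    Γ.g ≤ Γ.contPayoff σ (π i (view i m)) := by
  refine le_trans (le_of_eq ?_) (hSR i m hi fun _ => PMF.pure .R)
  have value_eq : ∀ x, π i (view i m) x ≠ 0 →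
      Γ.value (Function.update σ i fun _ => PMF.pure .R) x = Γ.g := by
    rintro ⟨θ, m'⟩ hx
    obtain rfl : θ = .G := hG _ hx
    exact Γ.value_good_eq_of_forall_risky (P := fun m => active m.length = i)
      (fun m hm y z => by simpa using hm) (fun m hm => by simp [riskProb_update_self hm])
      (hπ.active_eq hi hx)
  rw [contPayoff_eq_integral_value, integral_toMeasure_congr _ value_eq]
  simp

theorem riskProb_eq_one_of_sure_good (hSR : Γ.SequentiallyRational σ π) (hπ : Compatible π)
    (hi : active m.length = i) (hG : ∀ y, π i (view i m) y ≠ 0 → y.state = .G) :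
    riskProb σ m = 1 := by
  by_contra hr
  have armValue_le : ∀ x, π i (view i m) x ≠ 0 → Γ.armValue σ x .S ≤ Γ.δ * Γ.g := by
    rintro ⟨θ, m'⟩ hx
    obtain rfl : θ = .G := hG _ hx
    exact Γ.armValue_safe_good_le _ _
  have safe_le : ∫ x, Γ.armValue σ x .S ∂(π i (view i m)).toMeasure ≤ Γ.δ * Γ.g :=
    (integral_mono_ae (integrable_armValue _ _) (integrable_const _)
      (ae_toMeasure_of_forall_ne_zero _ armValue_le)).trans_eq (by simp)
  have g_le := ((g_le_contPayoff_of_sure_good hSR hπ hi hG).trans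
    (contPayoff_le_of_riskProb_ne_one hSR hπ hi hr)).trans safe_le
  exact g_le.not_gt (mul_lt_of_lt_one_left Γ.zero_lt_g Γ.δ_lt_one)

end SequentiallyRational

/-! ### Weights of full histories and beliefs -/

section Weight

variable (Γ : ExpGame)

/-- Prior probability of a state. -/
def prior : State → ℝ
  | .G => Γ.p0
  | .B => 1 - Γ.p0

/-- Probability of the outcome recorded in a move, given the state and its arm. -/
def outcomeProb : State → Move → ℝ
  | _, .safe => 1
  | .G, .risky true => Γ.lam
  | .G, .risky false => 1 - Γ.lam
  | .B, .risky true => 0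
  | .B, .risky false => 1

/-- Probability of a full history when players use `τ`. -/
noncomputable def weight (τ : Profile) (θ : State) : List Move → ℝ
  | [] => Γ.prior θ
  | x :: m => weight τ θ m * (τ (active m.length) (view (active m.length) m) x.arm).toReal
      * Γ.outcomeProb θ x

theorem prior_pos (θ : State) : 0 < Γ.prior θ := by
  cases θ
  · exact Γ.p0_pos
  · exact sub_pos.2 Γ.p0_lt_one

theorem outcomeProb_nonneg (θ : State) (x : Move) : 0 ≤ Γ.outcomeProb θ x := by
  have := Γ.lam_pos
  have := Γ.lam_lt_one
  obtain _ | _ := θ <;> obtain _ | _ | _ := x <;> simp only [outcomeProb] <;> linarith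

theorem weight_nonneg (τ : Profile) (θ : State) (m : List Move) : 0 ≤ Γ.weight τ θ m := by
  induction m with
  | nil => exact (Γ.prior_pos θ).le
  | cons x m ih =>
    exact mul_nonneg (mul_nonneg ih ENNReal.toReal_nonneg) (Γ.outcomeProb_nonneg θ x)

theorem outcome_apply (θ : State) (a : Arm) (y : Move) :
    Γ.outcome θ a y = if y.arm = a then ENNReal.ofReal (Γ.outcomeProb θ y) else 0 := by
  obtain _ | _ := θ <;> obtain _ | _ := a <;> obtain _ | _ | _ := y <;>
    simp [outcome, Move.arm, outcomeProb, PMF.map_apply, tsum_fintype, coin, PMF.ofFintype_apply]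

theorem step_apply_cons_self (σ : Profile) (θ : State) (y : Move) (m : List Move) :
    Γ.step σ ⟨θ, m⟩ ⟨θ, y :: m⟩ =
      σ (active m.length) (view (active m.length) m) y.arm
        * ENNReal.ofReal (Γ.outcomeProb θ y) := by
  have map_apply (a : Arm) : (Γ.outcome θ a).map (fun z => (⟨θ, z :: m⟩ : FullHist)) ⟨θ, y :: m⟩
      = Γ.outcome θ a y := by
    classical
    rw [PMF.map_apply, tsum_eq_single y fun z hz => by simp [hz.symm]]
    simp
  rw [step, PMF.bind_apply, tsum_fintype, sum_arm, map_apply, map_apply, outcome_apply,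
    outcome_apply]
  cases h : y.arm <;> simp

theorem step_apply_eq_zero (σ : Profile) {x z : FullHist}
    (h : ∀ y, z ≠ ⟨x.state, y :: x.moves⟩) : Γ.step σ x z = 0 := by
  rw [PMF.apply_eq_zero_iff]
  simpa [step, eq_comm] using fun a _ y _ => (h y).symm

theorem evolve_init_apply (τ : Profile) (θ : State) (m : List Move) :
    Γ.evolve τ Γ.init m.length ⟨θ, m⟩ = ENNReal.ofReal (Γ.weight τ θ m) := by
  classical
  induction m with
  | nil =>
    rw [List.length_nil, evolve, ExpGame.init, PMF.map_apply, tsum_fintype, Fintype.sum_bool]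
    cases θ <;> simp [weight, prior, coin, PMF.ofFintype_apply]
  | cons y m ih =>
    have step_eq_zero (x : FullHist) (hx : x ≠ ⟨θ, m⟩) : Γ.step τ x ⟨θ, y :: m⟩ = 0 := by
      refine Γ.step_apply_eq_zero τ fun z hz => hx ?_
      simp only [FullHist.mk.injEq, List.cons.injEq] at hz
      rw [hz.1, hz.2.2]
    rw [List.length_cons, evolve, PMF.bind_apply,
      tsum_eq_single ⟨θ, m⟩ fun x hx => by rw [step_eq_zero x hx, mul_zero], ih,
      step_apply_cons_self, weight,
      ENNReal.ofReal_mul (mul_nonneg (Γ.weight_nonneg _ _ _) ENNReal.toReal_nonneg),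
      ENNReal.ofReal_mul (Γ.weight_nonneg _ _ _), ENNReal.ofReal_toReal (PMF.apply_ne_top _ _),
      mul_assoc]

/-- Probability that player `i` gets to the private history `v`. -/
noncomputable def viewProb (τ : Profile) (i : Player) (v : PrivHist) : ENNReal :=
  (Γ.evolve τ Γ.init v.length).toMeasure {x | view i x.moves = v}

theorem posterior_view (τ : Profile) (i : Player) (y : FullHist) :
    Γ.posterior τ i (view i y.moves) y =
      (Γ.viewProb τ i (view i y.moves))⁻¹ * ENNReal.ofReal (Γ.weight τ y.state y.moves) := by
  rw [posterior, cond_apply .of_discrete, Set.inter_eq_right.2 (by simp),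
    PMF.toMeasure_apply_singleton _ _ .of_discrete, viewProb, length_view, evolve_init_apply]

theorem posterior_eq_zero (τ : Profile) {i : Player} {v : PrivHist} {y : FullHist}
    (h : view i y.moves ≠ v) : Γ.posterior τ i v y = 0 := by
  have empty : {x : FullHist | view i x.moves = v} ∩ {y} = ∅ := Set.inter_singleton_eq_empty.2 h
  rw [posterior, cond_apply .of_discrete, empty, measure_empty, mul_zero]

theorem weight_le_viewProb (τ : Profile) (i : Player) (θ : State) (m : List Move) :
    ENNReal.ofReal (Γ.weight τ θ m) ≤ Γ.viewProb τ i (view i m) := by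
  rw [← evolve_init_apply, viewProb, length_view,
    ← PMF.toMeasure_apply_singleton _ _ .of_discrete]
  exact measure_mono (by simp)

theorem posterior_mul_weight_le (τ : Profile) {i : Player} {v : PrivHist} (y : FullHist)
    {θ : State} {m : List Move} (hm : view i m = v) :
    Γ.posterior τ i v y * ENNReal.ofReal (Γ.weight τ θ m)
      ≤ ENNReal.ofReal (Γ.weight τ y.state y.moves) := by
  by_cases hy : view i y.moves = v
  · subst hy
    calc
      _ ≤ (Γ.viewProb τ i (view i y.moves))⁻¹ * ENNReal.ofReal (Γ.weight τ y.state y.moves)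
          * Γ.viewProb τ i (view i y.moves) := by
        rw [posterior_view]
        gcongr
        exact hm ▸ Γ.weight_le_viewProb τ i θ m
      _ = (Γ.viewProb τ i (view i y.moves))⁻¹ * Γ.viewProb τ i (view i y.moves)
          * ENNReal.ofReal (Γ.weight τ y.state y.moves) := by ring
      _ ≤ _ := mul_le_of_le_one_left' (ENNReal.inv_mul_le_one _)
  · simp [Γ.posterior_eq_zero τ hy]

variable {Γ}

theorem tendsto_weight {τ : ℕ → Profile} {σ : Profile}
    (h : ∀ i v a, Tendsto (fun n => τ n i v a) atTop (𝓝 (σ i v a))) (θ : State) (m : List Move) :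
    Tendsto (fun n => Γ.weight (τ n) θ m) atTop (𝓝 (Γ.weight σ θ m)) := by
  induction m with
  | nil => exact tendsto_const_nhds
  | cons x m ih =>
    exact (ih.mul ((ENNReal.tendsto_toReal (PMF.apply_ne_top _ _)).comp (h _ _ _))).mul_const _

theorem weight_bad_eq_zero (τ : Profile) {m : List Move} (hm : Move.risky true ∈ m) :
    Γ.weight τ .B m = 0 := by
  induction m with
  | nil => simp at hm
  | cons x m ih =>
    obtain rfl | h := List.mem_cons.1 hm
    · rw [weight, outcomeProb, mul_zero]
    · rw [weight, ih h, zero_mul, zero_mul]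

end Weight

section Odds

variable (Γ : ExpGame)

/-- Odds of the good state after `n` failed experiments. -/
noncomputable def odds (n : ℕ) : ℝ := Γ.p0 * (1 - Γ.lam) ^ n / (1 - Γ.p0)

theorem odds_pos (n : ℕ) : 0 < Γ.odds n :=
  div_pos (mul_pos Γ.p0_pos (pow_pos (sub_pos.2 Γ.lam_lt_one) n)) (sub_pos.2 Γ.p0_lt_one)

theorem odds_succ (n : ℕ) : Γ.odds (n + 1) = (1 - Γ.lam) * Γ.odds n := by
  rw [odds, odds, pow_succ]
  ring

theorem weight_good_map_failed (τ : Profile) (h : List Arm) :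
    Γ.weight τ .G (h.map Arm.failed) = Γ.odds (numExp h) * Γ.weight τ .B (h.map Arm.failed) := by
  induction h with
  | nil =>
    have := (sub_pos.2 Γ.p0_lt_one).ne'
    simp only [List.map_nil, weight, prior, numExp, List.count_nil, odds, pow_zero]
    field_simp
  | cons a h ih =>
    cases a
    · rw [numExp, List.count_cons_of_ne (by simp)]
      simp only [List.map_cons, Arm.failed, weight, ih, outcomeProb, numExp]
      ring
    · rw [numExp, List.count_cons_self, odds_succ]
      simp only [List.map_cons, Arm.failed, weight, ih, outcomeProb, numExp]
      ring

theorem iterate_φ_p0 (n : ℕ) : Γ.φ^[n] Γ.p0 = Γ.odds n / (1 + Γ.odds n) := by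
  induction n with
  | zero =>
    have := (sub_pos.2 Γ.p0_lt_one).ne'
    simp only [Function.iterate_zero, id, odds, pow_zero, mul_one]
    field_simp
    ring
  | succ n ih =>
    have odds_pos := Γ.odds_pos n
    have lam_compl_pos := sub_pos.2 Γ.lam_lt_one
    have denominator : Γ.odds n / (1 + Γ.odds n) * (1 - Γ.lam) + 1 - Γ.odds n / (1 + Γ.odds n)
        = (1 + (1 - Γ.lam) * Γ.odds n) / (1 + Γ.odds n) := by
      field_simp
      ring
    rw [Function.iterate_succ_apply', ih, odds_succ, φ, denominator]
    field_simp

end Odds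

section Consistent

variable {Γ : ExpGame} {σ : Profile} {π : Beliefs} {i : Player} {m : List Move}

theorem Consistent.compatible (hC : Γ.Consistent σ π) : Compatible π := by
  intro i m y hy
  obtain ⟨τ, -, -, hτ⟩ := hC
  by_contra hv
  exact hy (tendsto_nhds_unique (hτ i m y) (by simp [Γ.posterior_eq_zero _ hv]))

/-- Bayes' rule in a form that is also valid off the path of play. -/
theorem Consistent.mul_weight_le (hC : Γ.Consistent σ π) (y : FullHist) {θ : State}
    {m' : List Move} (hm : view i m' = view i m) :
    π i (view i m) y * ENNReal.ofReal (Γ.weight σ θ m')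
      ≤ ENNReal.ofReal (Γ.weight σ y.state y.moves) := by
  obtain ⟨τ, -, hτ, hb⟩ := hC
  exact le_of_tendsto_of_tendsto'
    (ENNReal.Tendsto.mul (hb i m y) (.inr ENNReal.ofReal_ne_top)
      (ENNReal.tendsto_ofReal (tendsto_weight hτ θ m')) (.inr (PMF.apply_ne_top _ _)))
    (ENNReal.tendsto_ofReal (tendsto_weight hτ y.state y.moves))
    fun n => Γ.posterior_mul_weight_le (τ n) y hm

theorem Consistent.eq_zero_of_weight_eq_zero (hC : Γ.Consistent σ π) {y : FullHist}
    (hy : Γ.weight σ y.state y.moves = 0) {θ : State} {m' : List Move}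
    (hm : view i m' = view i m) (h0 : Γ.weight σ θ m' ≠ 0) : π i (view i m) y = 0 := by
  have mul_le_zero := hC.mul_weight_le y (θ := θ) hm
  rw [hy, ENNReal.ofReal_zero, nonpos_iff_eq_zero, mul_eq_zero] at mul_le_zero
  exact mul_le_zero.resolve_right
    (ENNReal.ofReal_pos.2 ((Γ.weight_nonneg _ _ _).lt_of_ne' h0)).ne'

theorem Consistent.apply_eq_mul (hC : Γ.Consistent σ π) {y z : FullHist} {r : ℝ} (hr : 0 ≤ r)
    (hv : view i y.moves = view i z.moves)
    (hw : ∀ τ, Γ.weight τ y.state y.moves = r * Γ.weight τ z.state z.moves) :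
    π i (view i m) y = ENNReal.ofReal r * π i (view i m) z := by
  obtain ⟨τ, -, -, hb⟩ := hC
  refine tendsto_nhds_unique (hb i m y) ((ENNReal.Tendsto.const_mul (hb i m z)
    (.inr ENNReal.ofReal_ne_top)).congr fun n => ?_)
  by_cases hz : view i z.moves = view i m
  · rw [← hz, posterior_view, ← hv, posterior_view, hw, ENNReal.ofReal_mul hr]
    ring
  · rw [posterior_eq_zero _ _ hz, posterior_eq_zero _ _ (hv ▸ hz), mul_zero]

theorem Consistent.risky_true_notMem (hC : Γ.Consistent σ π)
    {m' : List Move} (hm' : π i (view i m) ⟨.B, m'⟩ ≠ 0) : Move.risky true ∉ m' := by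
  intro success
  refine hm' ?_
  rw [hC.apply_eq_mul (y := ⟨.B, m'⟩) (z := ⟨.B, m'⟩) le_rfl rfl fun τ => by
    rw [weight_bad_eq_zero τ success, mul_zero], ENNReal.ofReal_zero, zero_mul]

theorem Consistent.eq_map_failed (hC : Γ.Consistent σ π) {h : List Arm}
    (hm : π i (failView i h) ⟨.B, m⟩ ≠ 0) : m = h.map Arm.failed := by
  rw [← map_failed_map_arm (hC.risky_true_notMem hm), map_arm_eq_of_view_eq (hC.compatible hm),
    map_arm_map_failed]

theorem Consistent.state_eq_good (hC : Γ.Consistent σ π) (hs : Successful i m) {y : FullHist}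
    (hy : π i (view i m) y ≠ 0) : y.state = .G := by
  obtain ⟨_ | _, m'⟩ := y
  · rfl
  · have hs' : Successful i m' := by rwa [Successful, hC.compatible hy]
    exact (hC.risky_true_notMem hy hs'.risky_true_mem).elim

theorem riskProb_eq_one_of_successful (hSE : Γ.IsSequentialEquilibrium σ π)
    (hs : Successful (active m.length) m) : riskProb σ m = 1 :=
  riskProb_eq_one_of_sure_good hSE.1 hSE.2.compatible rfl fun _ => hSE.2.state_eq_good hs

/-- Probability that player `i` assigns to the bad state when the public history is `h` and none of
his experiments was successful. In the bad state all experiments fail. -/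
noncomputable def badBelief (π : Beliefs) (i : Player) (h : List Arm) : ℝ :=
  (π i (failView i h) ⟨.B, h.map Arm.failed⟩).toReal

theorem badBelief_nonneg (π : Beliefs) (i : Player) (h : List Arm) : 0 ≤ badBelief π i h :=
  ENNReal.toReal_nonneg

theorem Consistent.pubBelief_eq (hC : Γ.Consistent σ π) (i : Player) (h : List Arm) :
    pubBelief π i h = 1 - badBelief π i h := by
  set μ := π i (failView i h) with hμ
  have bad_event : μ.toMeasure {x | x.state = .G}ᶜ = μ ⟨.B, h.map Arm.failed⟩ := by
    rw [← μ.toMeasure_apply_singleton _ .of_discrete]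
    refine measure_congr (eventuallyEq_set.2 (ae_toMeasure_of_forall_ne_zero μ fun y hy => ?_))
    obtain ⟨_ | _, m⟩ := y
    · exact iff_of_false (fun h => h rfl) (by simp)
    · exact iff_of_true (by simp) (congrArg _ (hC.eq_map_failed hy))
  rw [badBelief, pubBelief, belief, ← hμ, ← bad_event, prob_compl_eq_one_sub .of_discrete,
    ENNReal.toReal_sub_of_le prob_le_one ENNReal.one_ne_top, ENNReal.toReal_one, sub_sub_cancel]

theorem Consistent.good_eq_odds_mul (hC : Γ.Consistent σ π) (i : Player) (h : List Arm) :
    (π i (failView i h) ⟨.G, h.map Arm.failed⟩).toReal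
      = Γ.odds (numExp h) * badBelief π i h := by
  rw [badBelief, failView, hC.apply_eq_mul (y := ⟨.G, _⟩) (z := ⟨.B, _⟩)
    (Γ.odds_pos (numExp h)).le rfl fun τ => Γ.weight_good_map_failed τ h, ENNReal.toReal_mul,
    ENNReal.toReal_ofReal (Γ.odds_pos _).le]

variable (Γ π) in
/-- Probability that player `i` assigns to a past success of the other player when the public
history is `h` and none of his own experiments was successful: what remains besides the two full
histories in which all experiments failed. -/
noncomputable def rivalSuccess (i : Player) (h : List Arm) : ℝ :=
  1 - (1 + Γ.odds (numExp h)) * badBelief π i h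

theorem Consistent.rivalSuccess_nonneg (hC : Γ.Consistent σ π) (i : Player) (h : List Arm) :
    0 ≤ rivalSuccess Γ π i h := by
  classical
  set μ := π i (failView i h)
  have add_le : μ ⟨.G, h.map Arm.failed⟩ + μ ⟨.B, h.map Arm.failed⟩ ≤ 1 := by
    rw [← μ.tsum_coe, ← Finset.sum_pair (by simp)]
    exact ENNReal.sum_le_tsum _
  replace add_le := ENNReal.toReal_mono ENNReal.one_ne_top add_le
  rw [ENNReal.toReal_add (μ.apply_ne_top _) (μ.apply_ne_top _), hC.good_eq_odds_mul, ← badBelief,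
    ENNReal.toReal_one] at add_le
  rw [rivalSuccess]
  linarith

theorem Consistent.rivalSuccess_eq_zero (hC : Γ.Consistent σ π) {h : List Arm}
    (hp : pubBelief π i h = Γ.φ^[numExp h] Γ.p0) : rivalSuccess Γ π i h = 0 := by
  have one_add_pos := add_pos one_pos (Γ.odds_pos (numExp h))
  rw [hC.pubBelief_eq, iterate_φ_p0, eq_div_iff one_add_pos.ne'] at hp
  rw [rivalSuccess]
  linarith

theorem badBelief_pos_of_rivalSuccess_eq_zero {h : List Arm} (h0 : rivalSuccess Γ π i h = 0) :
    0 < badBelief π i h := by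
  refine (badBelief_nonneg π i h).lt_of_ne' fun hb => ?_
  rw [rivalSuccess, hb] at h0
  simp at h0

variable (Γ) in
/-- Expectation of `f` over the state when the public history is `h` and all experiments failed,
scaled so that the bad state has weight `1`. -/
noncomputable def failedMean (f : FullHist → ℝ) (h : List Arm) : ℝ :=
  f ⟨.B, h.map Arm.failed⟩ + Γ.odds (numExp h) * f ⟨.G, h.map Arm.failed⟩

theorem Consistent.integral_le (hC : Γ.Consistent σ π) {f : FullHist → ℝ} {C k : ℝ}
    (hf : ∀ x, |f x| ≤ C) {h : List Arm} (hk : ∀ m, π i (failView i h) ⟨.G, m⟩ ≠ 0 →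
      m ≠ h.map Arm.failed → f ⟨.G, m⟩ ≤ k) :
    ∫ x, f x ∂(π i (failView i h)).toMeasure
      ≤ badBelief π i h * failedMean Γ f h + rivalSuccess Γ π i h * k := by
  have two_points := integral_toMeasure_le_of_pair (π i (failView i h))
    (a := ⟨.B, h.map Arm.failed⟩) (b := ⟨.G, h.map Arm.failed⟩) (k := k)
    (integrable_of_abs_le _ hf) (by simp) (by
      rintro ⟨_ | _, m⟩ hm hB hG
      · exact hk m hm fun h => hG (h ▸ rfl)
      · exact (hB (by rw [hC.eq_map_failed hm])).elim)
  rw [hC.good_eq_odds_mul, ← badBelief] at two_points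
  rw [failedMean, rivalSuccess]
  linarith

theorem Consistent.le_integral (hC : Γ.Consistent σ π) {f : FullHist → ℝ} {C k : ℝ}
    (hf : ∀ x, |f x| ≤ C) {h : List Arm} (hk : ∀ m, π i (failView i h) ⟨.G, m⟩ ≠ 0 →
      m ≠ h.map Arm.failed → k ≤ f ⟨.G, m⟩) :
    badBelief π i h * failedMean Γ f h + rivalSuccess Γ π i h * k
      ≤ ∫ x, f x ∂(π i (failView i h)).toMeasure := by
  have neg_le := hC.integral_le (f := fun x => -f x) (fun x => (abs_neg _).trans_le (hf x))
    fun m hm hne => neg_le_neg (hk m hm hne)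
  rw [integral_neg, failedMean] at neg_le
  rw [failedMean]
  linarith

end Consistent

section LowOdds

variable (Γ : ExpGame)

/-! ### The encouragement cut-off -/

/-- Payoff in the good state of a player who experiments, thereby gets the other player to
experiment once if he failed, and collects `g` once one of the two has revealed a success. It is
`g` times the factor of `g` in the denominator of `pHat`. -/
noncomputable def encouragedGain : ℝ :=
  (1 - Γ.δ) * Γ.g + Γ.δ * (Γ.lam * Γ.g + (1 - Γ.lam) * (Γ.lam * (Γ.δ * Γ.g)))

theorem pHat_eq :
    Γ.pHat = (1 - Γ.δ) * Γ.c / ((1 - Γ.δ) * Γ.c + Γ.encouragedGain) := by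
  rw [pHat, encouragedGain]
  ring

theorem one_sub_δ_mul_g_le_encouragedGain : (1 - Γ.δ) * Γ.g ≤ Γ.encouragedGain := by
  have := Γ.zero_lt_g
  have := Γ.lam_pos
  have := Γ.δ_pos
  have := sub_pos.2 Γ.lam_lt_one
  exact le_add_of_nonneg_right (by positivity)

theorem encouragedGain_pos : 0 < Γ.encouragedGain :=
  (mul_pos (sub_pos.2 Γ.δ_lt_one) Γ.zero_lt_g).trans_le Γ.one_sub_δ_mul_g_le_encouragedGain

theorem one_sub_δ_mul_c_pos : 0 < (1 - Γ.δ) * Γ.c := mul_pos (sub_pos.2 Γ.δ_lt_one) Γ.c_pos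

theorem pHat_pos : 0 < Γ.pHat := by
  rw [pHat_eq]
  exact div_pos Γ.one_sub_δ_mul_c_pos (add_pos Γ.one_sub_δ_mul_c_pos Γ.encouragedGain_pos)

theorem lt_pHat_iff (p : ℝ) :
    p < Γ.pHat ↔ p * Γ.encouragedGain < (1 - p) * ((1 - Γ.δ) * Γ.c) := by
  rw [pHat_eq, lt_div_iff₀ (add_pos Γ.one_sub_δ_mul_c_pos Γ.encouragedGain_pos)]
  constructor <;> intro h <;> linarith

theorem pHat_lt_iff (p : ℝ) :
    Γ.pHat < p ↔ (1 - p) * ((1 - Γ.δ) * Γ.c) < p * Γ.encouragedGain := by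
  rw [pHat_eq, div_lt_iff₀ (add_pos Γ.one_sub_δ_mul_c_pos Γ.encouragedGain_pos)]
  constructor <;> intro h <;> linarith

theorem one_sub_iterate_φ_p0 (n : ℕ) : 1 - Γ.φ^[n] Γ.p0 = 1 / (1 + Γ.odds n) := by
  rw [iterate_φ_p0, one_sub_div (add_pos one_pos (Γ.odds_pos n)).ne', add_sub_cancel_right]

theorem iterate_φ_p0_lt_pHat_iff (n : ℕ) :
    Γ.φ^[n] Γ.p0 < Γ.pHat ↔ Γ.odds n * Γ.encouragedGain < (1 - Γ.δ) * Γ.c := by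
  rw [lt_pHat_iff, one_sub_iterate_φ_p0, iterate_φ_p0, div_mul_eq_mul_div, div_mul_eq_mul_div,
    one_mul, div_lt_div_iff_of_pos_right (add_pos one_pos (Γ.odds_pos n))]

theorem pHat_lt_iterate_φ_p0_iff (n : ℕ) :
    Γ.pHat < Γ.φ^[n] Γ.p0 ↔ (1 - Γ.δ) * Γ.c < Γ.odds n * Γ.encouragedGain := by
  rw [pHat_lt_iff, one_sub_iterate_φ_p0, iterate_φ_p0, div_mul_eq_mul_div, div_mul_eq_mul_div,
    one_mul, div_lt_div_iff_of_pos_right (add_pos one_pos (Γ.odds_pos n))]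

theorem odds_antitone : Antitone Γ.odds :=
  antitone_nat_of_succ_le fun n => by
    rw [odds_succ]
    exact mul_le_of_le_one_left (Γ.odds_pos n).le (sub_le_self _ Γ.lam_pos.le)

theorem tendsto_odds : Tendsto Γ.odds atTop (𝓝 0) := by
  have tendsto_pow := tendsto_pow_atTop_nhds_zero_of_lt_one (sub_pos.2 Γ.lam_lt_one).le
    (sub_lt_self 1 Γ.lam_pos)
  have tendsto_mul := tendsto_pow.const_mul (Γ.p0 / (1 - Γ.p0))
  rw [mul_zero] at tendsto_mul
  exact tendsto_mul.congr fun n => by rw [odds]; ring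

theorem exists_odds_mul_lt (r : ℝ) {s : ℝ} (hs : 0 < s) : ∃ N, Γ.odds N * r < s := by
  have h := Γ.tendsto_odds.mul_const r
  rw [zero_mul] at h
  exact (h.eventually (gt_mem_nhds hs)).exists

/-! ### Play when all experiments fail -/

variable {Γ}
variable {σ : Profile} {π : Beliefs}

theorem numExp_safe (h : List Arm) : numExp (.S :: h) = numExp h :=
  List.count_cons_of_ne (by simp)

theorem numExp_risky (h : List Arm) : numExp (.R :: h) = numExp h + 1 := List.count_cons_self

theorem riskProb_risky (s s' : Bool) (m : List Move) :
    riskProb σ (.risky s :: m) = riskProb σ (.risky s' :: m) := by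
  have hi : active m.length ≠ active (m.length + 1) := (active_succ_ne _).symm
  exact riskProb_congr (by simp only [List.length_cons, view_cons_other hi, Move.arm])

theorem failedMean_nextMean (f : FullHist → ℝ) (h : List Arm) :
    failedMean Γ (Γ.nextMean σ f) h =
      (1 - riskProb σ (h.map Arm.failed)) * failedMean Γ f (.S :: h)
        + riskProb σ (h.map Arm.failed) * (failedMean Γ f (.R :: h)
          + Γ.lam * Γ.odds (numExp h) * f ⟨.G, .risky true :: h.map Arm.failed⟩) := by
  simp only [failedMean, nextMean, outcomeMean, numExp_safe, numExp_risky, odds_succ,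
    List.map_cons, Arm.failed]
  ring

theorem failedMean_value (h : List Arm) :
    failedMean Γ (Γ.value σ) h =
      (1 - riskProb σ (h.map Arm.failed)) * failedMean Γ (Γ.armValue σ · .S) h
        + riskProb σ (h.map Arm.failed) * failedMean Γ (Γ.armValue σ · .R) h := by
  simp only [failedMean, value_eq_armValue]
  ring

theorem failedMean_armValue_safe (h : List Arm) :
    failedMean Γ (Γ.armValue σ · .S) h
      = Γ.δ * failedMean Γ (Γ.nextMean σ (Γ.value σ)) (.S :: h) := by
  simp only [failedMean, armValue, numExp_safe, List.map_cons, Arm.failed]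
  ring

theorem failedMean_armValue_risky (h : List Arm) :
    failedMean Γ (Γ.armValue σ · .R) h =
      Γ.odds (numExp h) * ((1 - Γ.δ) * Γ.g) - (1 - Γ.δ) * Γ.c
        + Γ.δ * (failedMean Γ (Γ.nextMean σ (Γ.value σ)) (.R :: h) + Γ.lam * Γ.odds (numExp h)
          * Γ.nextMean σ (Γ.value σ) ⟨.G, .risky true :: h.map Arm.failed⟩) := by
  simp only [failedMean, armValue, outcomeMean, gain, numExp_risky, odds_succ, List.map_cons,
    Arm.failed]
  ring

theorem failedMean_armValue_risky_le (h : List Arm) :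
    failedMean Γ (Γ.armValue σ · .R) h ≤ Γ.odds (numExp h) * Γ.g - (1 - Γ.δ) * Γ.c := by
  have := Γ.armValue_risky_bad_le σ (h.map Arm.failed)
  have := mul_le_mul_of_nonneg_left (Γ.armValue_risky_good_le σ (h.map Arm.failed))
    (Γ.odds_pos (numExp h)).le
  rw [failedMean]
  linarith

theorem value_safe_failed_eq_zero {h : List Arm} (hs : ∀ h', numExp h' = numExp h →
    riskProb σ (.safe :: h'.map Arm.failed) = 0) (θ : State) :
    Γ.value σ ⟨θ, .safe :: h.map Arm.failed⟩ = 0 := by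
  refine Γ.value_eq_zero_of_forall_safe
    (P := fun m => ∃ h', numExp h' = numExp h ∧ m = .safe :: h'.map Arm.failed) θ ?_ ?_
    ⟨h, rfl, rfl⟩
  · rintro _ ⟨h', hn, rfl⟩
    exact ⟨hs h' hn, .S :: .S :: h', by simpa only [numExp_safe] using hn, rfl⟩
  · rintro _ ⟨h', hn, rfl⟩ h0
    exact (h0 (hs (.S :: h') (by rwa [numExp_safe]))).elim

theorem failedMean_value_safe_eq_zero {h : List Arm} (hs : ∀ h', numExp h' = numExp h →
    riskProb σ (.safe :: h'.map Arm.failed) = 0) : failedMean Γ (Γ.value σ) (.S :: h) = 0 := by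
  simp only [failedMean, List.map_cons, Arm.failed, value_safe_failed_eq_zero hs, mul_zero,
    add_zero]

theorem failedMean_value_eq_of_riskProb_safe_eq_zero {h : List Arm}
    (hs : ∀ h', numExp h' = numExp h → riskProb σ (.safe :: h'.map Arm.failed) = 0) :
    failedMean Γ (Γ.value σ) h
      = riskProb σ (h.map Arm.failed) * failedMean Γ (Γ.armValue σ · .R) h := by
  have value_eq_zero : failedMean Γ (Γ.value σ) (.S :: .S :: h) = 0 :=
    failedMean_value_safe_eq_zero fun h' hn => hs h' (by rwa [← numExp_safe h])
  have riskProb_eq_zero : riskProb σ ((Arm.S :: h).map Arm.failed) = 0 := hs h rfl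
  rw [failedMean_value, failedMean_armValue_safe, failedMean_nextMean, riskProb_eq_zero,
    value_eq_zero]
  ring

/-! ### Below the cut-off: experiments after a choice of `S` -/

variable (Γ σ) in
/-- How much the move `R` after `h`, all earlier experiments having failed, is worth to the player
who moves next, in excess of what he obtains by waiting for that experiment to be successful
(expectation over the state and the outcome of this `R`, scaled as in `failedMean`). -/
noncomputable def excess (h : List Arm) : ℝ :=
  failedMean Γ (Γ.value σ) (.R :: h)
    + Γ.lam * Γ.odds (numExp h)
      * (Γ.value σ ⟨.G, .risky true :: h.map Arm.failed⟩ - Γ.δ * Γ.g)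

theorem failedMean_armValue_risky_le_of_excess_le {h : List Arm}
    (hs : ∀ h', numExp h < numExp h' → riskProb σ (.safe :: h'.map Arm.failed) = 0)
    {D : ℝ} (hD : 0 ≤ D) (he : excess Γ σ (.R :: h) ≤ D) :
    failedMean Γ (Γ.armValue σ · .R) h
      ≤ Γ.odds (numExp h) * Γ.encouragedGain - (1 - Γ.δ) * Γ.c + Γ.δ * D := by
  have ho := Γ.odds_pos (numExp h)
  have hlam := Γ.lam_pos
  have value_safe : failedMean Γ (Γ.value σ) (.S :: .R :: h) = 0 :=
    failedMean_value_safe_eq_zero fun h' hn => hs h' (by rw [hn, numExp_risky]; omega)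
  have next_le : failedMean Γ (Γ.nextMean σ (Γ.value σ)) (.R :: h)
      ≤ D + Γ.lam * ((1 - Γ.lam) * Γ.odds (numExp h)) * (Γ.δ * Γ.g) := by
    have bound_nonneg : 0 ≤ D + Γ.lam * ((1 - Γ.lam) * Γ.odds (numExp h)) * (Γ.δ * Γ.g) := by
      have := sub_pos.2 Γ.lam_lt_one
      have := Γ.δ_pos
      have := Γ.zero_lt_g
      positivity
    rw [failedMean_nextMean, value_safe, mul_zero, zero_add]
    refine (mul_le_mul_of_nonneg_left ?_ (riskProb_nonneg _ _)).trans
      (mul_le_of_le_one_left bound_nonneg (riskProb_le_one _ _))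
    rw [excess, numExp_risky, odds_succ] at he
    rw [numExp_risky, odds_succ]
    linarith
  have next_success_le := mul_le_mul_of_nonneg_left
    (Γ.nextMean_value_good_le σ (.risky true :: h.map Arm.failed)) (mul_pos hlam ho).le
  have := mul_le_mul_of_nonneg_left (add_le_add next_le next_success_le) Γ.δ_pos.le
  rw [failedMean_armValue_risky, encouragedGain]
  linarith

theorem excess_le_odds_mul_g (h : List Arm) : excess Γ σ h ≤ Γ.odds (numExp h) * Γ.g := by
  have ho := Γ.odds_pos (numExp h)
  have bad_le := Γ.value_bad_nonpos σ (.risky false :: h.map Arm.failed)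
  have good_le := mul_le_mul_of_nonneg_left
    (Γ.value_good_le σ (.risky false :: h.map Arm.failed))
    (mul_pos (sub_pos.2 Γ.lam_lt_one) ho).le
  have success_le := mul_le_mul_of_nonneg_left
    ((sub_le_self _ (mul_pos Γ.δ_pos Γ.zero_lt_g).le).trans
      (Γ.value_good_le σ (.risky true :: h.map Arm.failed))) (mul_pos Γ.lam_pos ho).le
  simp only [excess, failedMean, numExp_risky, odds_succ, List.map_cons, Arm.failed]
  linarith

/-- The excess at `h` is a fraction of the value of one more experiment, which by
`failedMean_armValue_risky_le_of_excess_le` is bounded by the discounted excess one round later. -/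
theorem excess_nonpos {n : ℕ} (hn : Γ.odds n * Γ.encouragedGain ≤ (1 - Γ.δ) * Γ.c)
    (hs : ∀ h', n < numExp h' → riskProb σ (.safe :: h'.map Arm.failed) = 0)
    {h : List Arm} (hh : n ≤ numExp h) : excess Γ σ h ≤ 0 := by
  refine nonpos_of_forall_le_imp_le_mul (P := fun h => n ≤ numExp h) (f := excess Γ σ)
    (M := Γ.odds 0 * Γ.g) Γ.δ_pos.le Γ.δ_lt_one (fun h _ => ?_) (fun D hD hyp h hh => ?_) hh
  · exact (excess_le_odds_mul_g h).trans
      (mul_le_mul_of_nonneg_right (Γ.odds_antitone (Nat.zero_le _)) Γ.zero_lt_g.le)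
  have ho := Γ.odds_pos (numExp h)
  have hlt : n < numExp (.R :: h) := by rw [numExp_risky]; omega
  set ρ := riskProb σ (.risky false :: h.map Arm.failed) with hρ
  have armValue_le := failedMean_armValue_risky_le_of_excess_le (Γ := Γ) (h := .R :: h)
    (fun h' hlt' => hs h' (hlt.trans hlt')) hD
    (hyp (.R :: .R :: h) (by simp only [numExp_risky]; omega))
  have value_eq : failedMean Γ (Γ.value σ) (.R :: h)
      = ρ * failedMean Γ (Γ.armValue σ · .R) (.R :: h) :=
    failedMean_value_eq_of_riskProb_safe_eq_zero fun h' hn' => hs h' (hn' ▸ hlt)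
  have value_success_le : Γ.value σ ⟨.G, .risky true :: h.map Arm.failed⟩ - Γ.δ * Γ.g
      ≤ ρ * ((1 - Γ.δ) * Γ.g) := by
    rw [value_eq_armValue, riskProb_risky true false, ← hρ]
    have := mul_le_mul_of_nonneg_left
      (Γ.armValue_safe_good_le σ (.risky true :: h.map Arm.failed))
      (sub_nonneg.2 (riskProb_le_one σ (.risky false :: h.map Arm.failed)))
    have := mul_le_mul_of_nonneg_left
      (Γ.armValue_risky_good_le σ (.risky true :: h.map Arm.failed))
      (riskProb_nonneg σ (.risky false :: h.map Arm.failed))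
    linarith
  have low_odds : (1 - Γ.lam) * Γ.odds (numExp h) * Γ.encouragedGain
      + Γ.lam * Γ.odds (numExp h) * ((1 - Γ.δ) * Γ.g) ≤ (1 - Γ.δ) * Γ.c := by
    have := mul_le_mul_of_nonneg_left Γ.one_sub_δ_mul_g_le_encouragedGain
      (mul_pos Γ.lam_pos ho).le
    have := mul_le_mul_of_nonneg_right (Γ.odds_antitone hh) Γ.encouragedGain_pos.le
    linarith
  rw [numExp_risky, odds_succ] at armValue_le
  calc excess Γ σ h
      ≤ ρ * (failedMean Γ (Γ.armValue σ · .R) (.R :: h)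
          + Γ.lam * Γ.odds (numExp h) * ((1 - Γ.δ) * Γ.g)) := by
        have := mul_le_mul_of_nonneg_left value_success_le (mul_pos Γ.lam_pos ho).le
        rw [excess, value_eq]
        linarith
    _ ≤ ρ * (Γ.δ * D) := mul_le_mul_of_nonneg_left (by linarith) (riskProb_nonneg _ _)
    _ ≤ Γ.δ * D := mul_le_of_le_one_left (mul_nonneg Γ.δ_pos.le hD) (riskProb_le_one _ _)

theorem failedMean_armValue_risky_le_of_low_odds {h : List Arm}
    (hs : ∀ h', numExp h < numExp h' → riskProb σ (.safe :: h'.map Arm.failed) = 0)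
    (hn : Γ.odds (numExp h) * Γ.encouragedGain ≤ (1 - Γ.δ) * Γ.c) :
    failedMean Γ (Γ.armValue σ · .R) h
      ≤ Γ.odds (numExp h) * Γ.encouragedGain - (1 - Γ.δ) * Γ.c := by
  have excess_le : excess Γ σ (.R :: h) ≤ 0 :=
    excess_nonpos hn hs ((Nat.le_succ _).trans_eq (numExp_risky h).symm)
  exact (failedMean_armValue_risky_le_of_excess_le hs le_rfl excess_le).trans_eq (by ring)

theorem contPayoff_nonneg (hSE : Γ.IsSequentialEquilibrium σ π) {i : Player} {m : List Move}
    (hi : active m.length = i) : 0 ≤ Γ.contPayoff σ (π i (view i m)) := by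
  refine le_of_eq_of_le ?_ (hSE.1 i m hi fun _ => PMF.pure .S)
  have value_eq_zero : ∀ y, π i (view i m) y ≠ 0 →
      Γ.value (Function.update σ i fun _ => PMF.pure .S) y = 0 := fun y hy =>
    Γ.value_eq_zero_of_forall_safe (P := fun m => active m.length = i) y.state
      (fun m hm => ⟨by simp [riskProb_update_self hm], by simpa using hm⟩)
      (fun m hm _ s => by simpa using hm) (hSE.2.compatible.active_eq hi hy)
  rw [contPayoff_eq_integral_value, integral_toMeasure_congr _ value_eq_zero, integral_zero]

variable (Γ) in
/-- Beliefs under which a choice of `S` reveals that all past experiments of the other player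
failed. Reasonable beliefs satisfy in addition a condition on a choice of `R` that follows `S`. -/
def RevealingSafe (π : Beliefs) : Prop :=
  ∀ h : List Arm, pubBelief π (active (Arm.S :: h).length) (Arm.S :: h) = Γ.φ^[numExp h] Γ.p0

theorem riskProb_safe_eq_zero_of_failedMean_neg (hSE : Γ.IsSequentialEquilibrium σ π)
    (hR : Γ.RevealingSafe π) {h : List Arm}
    (hneg : failedMean Γ (Γ.armValue σ · .R) (.S :: h) < 0) :
    riskProb σ (.safe :: h.map Arm.failed) = 0 := by
  by_contra h0
  set i := active (Arm.S :: h).length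
  have hi : active (Move.safe :: h.map Arm.failed).length = i := by simp [i]
  have no_rivalSuccess : rivalSuccess Γ π i (.S :: h) = 0 :=
    hSE.2.rivalSuccess_eq_zero (by rw [numExp_safe]; exact hR h)
  have integral_le := hSE.2.integral_le (Γ.abs_armValue_le σ · .R) (i := i) (h := .S :: h)
    fun m _ _ => Γ.armValue_risky_good_le σ m
  rw [no_rivalSuccess, zero_mul, add_zero] at integral_le
  exact (mul_neg_of_pos_of_neg (badBelief_pos_of_rivalSuccess_eq_zero no_rivalSuccess)
    hneg).not_ge <| ((contPayoff_nonneg hSE hi).trans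
      (contPayoff_le_of_riskProb_ne_zero hSE.1 hSE.2.compatible hi h0)).trans integral_le

/-- Induction down from a number of experiments at which the odds are too low for an experiment
that would produce `g` for sure in the good state. -/
theorem riskProb_safe_eq_zero_of_low_odds (hSE : Γ.IsSequentialEquilibrium σ π)
    (hR : Γ.RevealingSafe π) {h : List Arm}
    (hn : Γ.odds (numExp h) * Γ.encouragedGain < (1 - Γ.δ) * Γ.c) :
    riskProb σ (.safe :: h.map Arm.failed) = 0 := by
  obtain ⟨N, hN⟩ := Γ.exists_odds_mul_lt Γ.g Γ.one_sub_δ_mul_c_pos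
  induction hd : N - numExp h using Nat.strong_induction_on generalizing h with
  | _ d ih =>
  refine riskProb_safe_eq_zero_of_failedMean_neg hSE hR ?_
  obtain hle | hlt := le_or_gt N (numExp h)
  · have := mul_le_mul_of_nonneg_right (Γ.odds_antitone hle) Γ.zero_lt_g.le
    refine (failedMean_armValue_risky_le _).trans_lt ?_
    rw [numExp_safe]
    linarith
  · refine (failedMean_armValue_risky_le_of_low_odds (fun h' hlt' => ?_) ?_).trans_lt ?_
    · rw [numExp_safe] at hlt'
      exact ih (N - numExp h') (by omega)
        ((mul_le_mul_of_nonneg_right (Γ.odds_antitone hlt'.le)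
          Γ.encouragedGain_pos.le).trans_lt hn) rfl
    · rw [numExp_safe]; exact hn.le
    · rw [numExp_safe]; exact sub_neg.2 hn

end LowOdds

section Deviation

variable {Γ : ExpGame} {σ : Profile} {π : Beliefs} {i : Player}

/-! ### Pure deviations -/

section PureStrategy

variable {c P : PrivHist → Prop} {m : List Move}

open Classical in
/-- The pure strategy that experiments exactly at the private histories in `c`. -/
noncomputable def pureStrategy (c : PrivHist → Prop) : Strategy :=
  fun v => PMF.pure (if c v then .R else .S)

theorem riskProb_pureStrategy_eq_one (hi : active m.length = i) (h : c (view i m)) :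
    riskProb (Function.update σ i (pureStrategy c)) m = 1 := by
  rw [riskProb_update_self hi]
  simp [pureStrategy, h]

theorem riskProb_pureStrategy_eq_zero (hi : active m.length = i) (h : ¬ c (view i m)) :
    riskProb (Function.update σ i (pureStrategy c)) m = 0 := by
  rw [riskProb_update_self hi]
  simp [pureStrategy, h]

theorem value_pureStrategy_good_eq_of_invariant (hP : ∀ v x, P v → P (x :: v))
    (hc : ∀ v, P v → c v) (hi : active m.length = i) (h : P (view i m)) :
    Γ.value (Function.update σ i (pureStrategy c)) ⟨.G, m⟩ = Γ.g :=
  Γ.value_good_eq_of_forall_risky (P := fun m => active m.length = i ∧ P (view i m))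
    (fun _ hm _ _ => ⟨by simpa using hm.1, hP _ _ (hP _ _ hm.2)⟩)
    (fun _ hm => riskProb_pureStrategy_eq_one hm.1 (hc _ hm.2)) ⟨hi, h⟩

theorem value_pureStrategy_eq_zero_of_invariant
    (hP : ∀ v a, P v → P (Sum.inr a :: Sum.inl .safe :: v)) (hc : ∀ v, P v → ¬ c v)
    (hi : active m.length = i) (h : P (view i m)) (θ : State) :
    Γ.value (Function.update σ i (pureStrategy c)) ⟨θ, m⟩ = 0 := by
  have invariant_step (m : List Move) (hm : active m.length = i ∧ P (view i m)) (z : Move) :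
      active (z :: .safe :: m : List Move).length = i ∧ P (view i (z :: .safe :: m)) := by
    refine ⟨by simpa using hm.1, ?_⟩
    rw [view_cons_other (by simpa [← hm.1] using active_succ_ne _), view_cons_own hm.1]
    exact hP _ _ hm.2
  exact Γ.value_eq_zero_of_forall_safe (P := fun m => active m.length = i ∧ P (view i m)) θ
    (fun m hm => ⟨riskProb_pureStrategy_eq_zero hm.1 (hc _ hm.2), invariant_step m hm _⟩)
    (fun m hm _ _ => invariant_step m hm _) ⟨hi, h⟩

theorem value_pureStrategy_good_eq_of_successful (hc : ∀ v, Sum.inl (.risky true) ∈ v → c v)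
    (hi : active m.length = i) (hs : Successful i m) :
    Γ.value (Function.update σ i (pureStrategy c)) ⟨.G, m⟩ = Γ.g :=
  value_pureStrategy_good_eq_of_invariant (P := fun v : PrivHist => Sum.inl (Move.risky true) ∈ v)
    (fun _ _ h => List.mem_cons_of_mem _ h) hc hi hs

end PureStrategy

/-! ### Probing the other player -/

section Probing

variable {N k : ℕ} {m : List Move}

/-- The private history `v` shows that the other player chose `R` right after the first `k` moves
of the game. -/
def SawRisky (k : ℕ) (v : PrivHist) : Prop :=
  ∃ w : PrivHist, w.length = k ∧ Sum.inr Arm.R :: w <:+ v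

theorem sawRisky_cons_iff {x : Move ⊕ Arm} {v : PrivHist} :
    SawRisky k (x :: v) ↔ v.length = k ∧ x = Sum.inr .R ∨ SawRisky k v := by
  simp only [SawRisky, List.suffix_cons_iff, List.cons.injEq]
  grind

theorem SawRisky.lt_length {v : PrivHist} (h : SawRisky k v) : k < v.length := by
  obtain ⟨w, rfl, hw⟩ := h
  exact hw.length_le

/-- The rule to experiment as long as fewer than `N` moves were made, then to choose `S` once, and
to resume experimenting for good if the other player reacts to this `S` by choosing `R`. After a
success of his own, a player always experiments. -/
def Probing (N : ℕ) (v : PrivHist) : Prop :=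
  Sum.inl (.risky true) ∈ v ∨ v.length < N ∨ SawRisky (N + 1) v

/-- The profile `σ` with player `i` deviating to the rule `Probing N`. -/
noncomputable abbrev probe (σ : Profile) (i : Player) (N : ℕ) : Profile :=
  Function.update σ i (pureStrategy (Probing N))

theorem not_probing (hs : ¬ Successful i m) (hN : m.length = N) : ¬ Probing N (view i m) := by
  rintro (h | h | h)
  · exact hs h
  · rw [length_view] at h; omega
  · have := h.lt_length
    rw [length_view] at this; omega

theorem value_probe_eq_δ_mul (hi : active m.length = i) (hN : m.length = N)
    (hs : ¬ Successful i m) (θ : State) :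
    Γ.value (probe σ i N) ⟨θ, m⟩
      = Γ.δ * Γ.nextMean (probe σ i N) (Γ.value (probe σ i N)) ⟨θ, .safe :: m⟩ := by
  rw [value_eq_armValue, riskProb_pureStrategy_eq_zero hi (not_probing hs hN), armValue]
  ring

theorem value_probe_eq_zero (hi : active m.length = i) (hN : m.length = N)
    (hs : ¬ Successful i m) (h0 : riskProb σ (.safe :: m) = 0) (θ : State) :
    Γ.value (probe σ i N) ⟨θ, m⟩ = 0 := by
  have rival_active : active (Move.safe :: m).length ≠ i := hi ▸ active_succ_ne _
  have stops : Γ.value (probe σ i N) ⟨θ, .safe :: .safe :: m⟩ = 0 := by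
    refine value_pureStrategy_eq_zero_of_invariant (P := fun v => N + 2 ≤ v.length ∧ ¬ Probing N v)
      (fun v a hv => ⟨hv.1.trans (by grind), ?_⟩) (fun v hv => hv.2) (by simpa using hi)
      ⟨by simp [hN], ?_⟩ θ
    · have := hv.2
      have := hv.1
      simp only [Probing, sawRisky_cons_iff, List.mem_cons, List.length_cons] at *
      grind
    · have seen : Sum.inl (.risky true) ∉ view i m := hs
      have : ¬ SawRisky (N + 1) (view i m) := fun h => by simpa [hN] using h.lt_length
      simp only [Probing, sawRisky_cons_iff, view_cons_other rival_active, view_cons_own hi,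
        List.mem_cons, List.length_cons, length_view, Move.arm]
      grind
  rw [value_probe_eq_δ_mul hi hN hs, nextMean, riskProb_update_other rival_active, h0, stops]
  ring

theorem δ_mul_g_le_value_probe (hi : active m.length = i) (hN : m.length = N)
    (h1 : riskProb σ (.safe :: m) = 1) : Γ.δ * Γ.g ≤ Γ.value (probe σ i N) ⟨.G, m⟩ := by
  by_cases hs : Successful i m
  · rw [value_pureStrategy_good_eq_of_successful (fun _ => .inl) hi hs]
    exact mul_le_of_le_one_left Γ.zero_lt_g.le Γ.δ_lt_one.le
  have rival_active : active (Move.safe :: m).length ≠ i := hi ▸ active_succ_ne _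
  have resumes (s : Bool) : Γ.value (probe σ i N) ⟨.G, .risky s :: .safe :: m⟩ = Γ.g := by
    refine value_pureStrategy_good_eq_of_invariant (P := SawRisky (N + 1))
      (fun _ _ h => sawRisky_cons_iff.2 (.inr h)) (fun _ h => .inr (.inr h)) (by simpa using hi) ?_
    rw [view_cons_other rival_active]
    exact sawRisky_cons_iff.2 (.inl ⟨by simp [hN], rfl⟩)
  rw [value_probe_eq_δ_mul hi hN hs, nextMean, riskProb_update_other rival_active, h1]
  simp only [outcomeMean, resumes]
  exact le_of_eq (by ring)

end Probing

/-! ### No experiments below the cut-off -/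

variable {h : List Arm}

/-- If a failing rival would choose `S` after `S`, then choosing `S` reveals his past success. -/
theorem rivalSuccess_mul_le_contPayoff (hSE : Γ.IsSequentialEquilibrium σ π)
    (hi : active h.length = i) (h0 : riskProb σ (.safe :: h.map Arm.failed) = 0) :
    rivalSuccess Γ π i h * (Γ.δ * Γ.g) ≤ Γ.contPayoff σ (π i (failView i h)) := by
  have hi' : active (h.map Arm.failed).length = i := by simpa using hi
  have value_failed (θ : State) : Γ.value (probe σ i h.length) ⟨θ, h.map Arm.failed⟩ = 0 :=
    value_probe_eq_zero hi' (by simp) (not_successful_map_failed i h) h0 θ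
  have value_informed (m : List Move) (hm : π i (failView i h) ⟨.G, m⟩ ≠ 0)
      (hne : m ≠ h.map Arm.failed) :
      Γ.δ * Γ.g ≤ Γ.value (probe σ i h.length) ⟨.G, m⟩ := by
    have hv : view i m = failView i h := hSE.2.compatible hm
    have hl : m.length = h.length := by simpa using length_eq_of_view_eq hv
    obtain ⟨j, hj, hs⟩ := (eq_map_failed_or_successful_of_view_eq_failView hv).resolve_left hne
    obtain rfl : j = active (m.length + 1) := eq_active_succ_of_ne (by rw [hl, hi]; exact hj)
    exact δ_mul_g_le_value_probe (by rw [hl, hi]) hl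
      (riskProb_eq_one_of_successful hSE (hs.cons .safe))
  have le_deviation := hSE.2.le_integral (Γ.abs_value_le _) value_informed
  rw [failedMean, value_failed, value_failed, mul_zero, add_zero, mul_zero, zero_add,
    ← contPayoff_eq_integral_value] at le_deviation
  exact le_deviation.trans (hSE.1 i (h.map Arm.failed) hi' _)

theorem Consistent.odds_mul_lt_of_pubBelief_lt_pHat (hC : Γ.Consistent σ π)
    (hp : pubBelief π i h < Γ.pHat) :
    Γ.odds (numExp h) * Γ.encouragedGain < (1 - Γ.δ) * Γ.c := by
  rw [lt_pHat_iff, hC.pubBelief_eq, sub_sub_cancel] at hp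
  have rival_nonneg := hC.rivalSuccess_nonneg i h
  rw [rivalSuccess] at rival_nonneg
  have odds_mul_le : badBelief π i h * (Γ.odds (numExp h) * Γ.encouragedGain)
      ≤ (1 - badBelief π i h) * Γ.encouragedGain := by
    have := mul_nonneg rival_nonneg Γ.encouragedGain_pos.le
    linarith
  exact lt_of_mul_lt_mul_left (odds_mul_le.trans_lt hp) (badBelief_nonneg π i h)

theorem riskProb_eq_zero_of_pubBelief_lt_pHat (hSE : Γ.IsSequentialEquilibrium σ π)
    (hR : Γ.RevealingSafe π) (hp : pubBelief π (active h.length) h < Γ.pHat) :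
    riskProb σ (h.map Arm.failed) = 0 := by
  by_contra h0
  set i := active h.length with hi
  have low_odds := hSE.2.odds_mul_lt_of_pubBelief_lt_pHat hp
  have failed_le : failedMean Γ (Γ.armValue σ · .R) h
      ≤ Γ.odds (numExp h) * Γ.encouragedGain - (1 - Γ.δ) * Γ.c :=
    failedMean_armValue_risky_le_of_low_odds (fun h' hlt => riskProb_safe_eq_zero_of_low_odds hSE
      hR ((mul_le_mul_of_nonneg_right (Γ.odds_antitone hlt.le)
        Γ.encouragedGain_pos.le).trans_lt low_odds)) low_odds.le
  have risky_le := hSE.2.integral_le (Γ.abs_armValue_le σ · .R) (i := i) (h := h)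
    fun m _ _ => Γ.armValue_risky_good_le σ m
  have waiting_le := (rivalSuccess_mul_le_contPayoff hSE hi.symm
    (riskProb_safe_eq_zero_of_low_odds hSE hR low_odds)).trans
    ((contPayoff_le_of_riskProb_ne_zero hSE.1 hSE.2.compatible (by simp [hi]) h0).trans risky_le)
  rw [lt_pHat_iff, hSE.2.pubBelief_eq, sub_sub_cancel] at hp
  have := mul_le_mul_of_nonneg_left failed_le (badBelief_nonneg π i h)
  have := mul_le_mul_of_nonneg_left Γ.one_sub_δ_mul_g_le_encouragedGain
    (hSE.2.rivalSuccess_nonneg i h)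
  simp only [rivalSuccess] at *
  linarith

theorem riskProb_map_failed (σ : Profile) (h : List Arm) : riskProb σ (h.map Arm.failed)
    = (σ (active h.length) (failView (active h.length) h) .R).toReal := by
  rw [riskProb, List.length_map, failView]

end Deviation

section Play

variable {Γ : ExpGame} {σ : Profile} {π : Beliefs} {i : Player}

/-! ### The law of the infinite play -/

theorem playLaw_mem_and_succ_mem (σ : Profile) (n : ℕ) (s t : Set FullHist) :
    Γ.playLaw σ {ω | ω n ∈ s ∧ ω (n + 1) ∈ t}
      = ∫⁻ ω in {ω | ω n ∈ s}, (Γ.step σ (ω n)).toMeasure t ∂Γ.playLaw σ := by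
  have compProd_eq := Kernel.map_frestrictLe_trajMeasure_compProd_eq_map_trajMeasure
    (X := fun _ => FullHist) (μ₀ := Γ.init.toMeasure) (a := n)
    (κ := fun n => (Γ.stepKernel σ).comap (fun z : Finset.Iic n → FullHist => z ⟨n, by simp⟩)
      (measurable_pi_apply _))
  have meas_s : MeasurableSet {z : Finset.Iic n → FullHist | z ⟨n, by simp⟩ ∈ s} :=
    measurable_pi_apply (⟨n, by simp⟩ : Finset.Iic n) (.of_discrete (s := s))
  have meas_t : MeasurableSet t := .of_discrete
  replace compProd_eq := congrArg (fun μ => μ ({z | z ⟨n, by simp⟩ ∈ s} ×ˢ t)) compProd_eq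
  beta_reduce at compProd_eq
  rw [Measure.compProd_apply_prod meas_s meas_t,
    Measure.map_apply (by fun_prop) (meas_s.prod meas_t),
    setLIntegral_map meas_s (Kernel.measurable_coe _ meas_t) (by fun_prop)] at compProd_eq
  exact compProd_eq.symm

theorem playLaw_zero_mem (σ : Profile) (s : Set FullHist) :
    Γ.playLaw σ {ω | ω 0 ∈ s} = Γ.init.toMeasure s := by
  have map_eq : (Γ.playLaw σ).map (Preorder.frestrictLe 0)
      = Γ.init.toMeasure.map (MeasurableEquiv.piUnique fun _ : Finset.Iic 0 => FullHist).symm := by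
    rw [playLaw, Kernel.trajMeasure, Measure.map_comp _ _ (by fun_prop),
      Kernel.traj_map_frestrictLe, Kernel.partialTraj_self, Measure.id_comp]
  have meas_s : MeasurableSet {z : Finset.Iic 0 → FullHist | z ⟨0, by simp⟩ ∈ s} :=
    measurable_pi_apply (⟨0, by simp⟩ : Finset.Iic 0) (.of_discrete (s := s))
  replace map_eq := congrArg (fun μ => μ {z | z ⟨0, by simp⟩ ∈ s}) map_eq
  beta_reduce at map_eq
  rwa [Measure.map_apply (by fun_prop) meas_s, Measure.map_apply (by fun_prop) meas_s] at map_eq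

theorem map_playLaw (σ : Profile) (n : ℕ) :
    (Γ.playLaw σ).map (fun ω => ω n) = (Γ.evolve σ Γ.init n).toMeasure := by
  ext s hs
  rw [Measure.map_apply (measurable_pi_apply n) hs]
  induction n generalizing s with
  | zero => exact playLaw_zero_mem σ s
  | succ n ih =>
    have map_eq : (Γ.playLaw σ).map (fun ω => ω n) = (Γ.evolve σ Γ.init n).toMeasure := by
      ext t ht
      rw [Measure.map_apply (measurable_pi_apply n) ht, ih t ht]
    have step_eq := playLaw_mem_and_succ_mem (Γ := Γ) σ n Set.univ s
    simp only [Set.mem_univ, true_and, Set.ofPred_true, Measure.restrict_univ] at step_eq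
    rw [Set.preimage, step_eq, evolve, PMF.toMeasure_bind_apply _ _ _ hs,
      ← lintegral_map (f := fun x => (Γ.step σ x).toMeasure s) .of_discrete
        (measurable_pi_apply n), map_eq, lintegral_countable']
    simp only [PMF.toMeasure_apply_singleton _ _ MeasurableSet.of_discrete, mul_comm]

theorem playLaw_path_pos {L : ℕ} {y : ℕ → FullHist} (h0 : Γ.evolve σ Γ.init L (y 0) ≠ 0)
    (hstep : ∀ k, Γ.step σ (y k) (y (k + 1)) = 1) :
    0 < Γ.playLaw σ {ω | ∀ k, ω (L + k) = y k} := by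
  set leaves : ℕ → Set (ℕ → FullHist) :=
    fun k => {ω | ω (L + k) ∈ ({y k} : Set FullHist) ∧ ω (L + k + 1) ∈ ({y (k + 1)} : Set _)ᶜ}
  have leaves_null (k : ℕ) : Γ.playLaw σ (leaves k) = 0 := by
    have meas : MeasurableSet {ω : ℕ → FullHist | ω (L + k) ∈ ({y k} : Set FullHist)} :=
      measurable_pi_apply (L + k) (.of_discrete (s := {y k}))
    rw [playLaw_mem_and_succ_mem, setLIntegral_congr_fun (g := fun _ => 0) meas, lintegral_zero]
    intro ω (hω : ω (L + k) = y k)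
    simp only [hω]
    rw [prob_compl_eq_zero_iff .of_discrete, PMF.toMeasure_apply_singleton _ _ .of_discrete,
      hstep k]
  have cover : (fun ω => ω L) ⁻¹' {y 0} ⊆ {ω | ∀ k, ω (L + k) = y k} ∪ ⋃ k, leaves k := by
    intro ω hω
    refine or_iff_not_imp_right.2 fun stays k => ?_
    induction k with
    | zero => exact hω
    | succ k ih =>
      by_contra hk
      exact stays (Set.mem_iUnion.2 ⟨k, ih, hk⟩)
  have start_le := (measure_mono (μ := Γ.playLaw σ) cover).trans (measure_union_le _ _)
  rw [measure_iUnion_null leaves_null, add_zero,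
    ← Measure.map_apply (measurable_pi_apply L) .of_discrete, map_playLaw,
    PMF.toMeasure_apply_singleton _ _ .of_discrete] at start_le
  exact (pos_iff_ne_zero.2 h0).trans_le start_le

/-! ### Public histories reached in the bad state -/

section Reach

variable {h : List Arm}

theorem weight_safe (τ : Profile) (θ : State) (m : List Move) :
    Γ.weight τ θ (.safe :: m) = Γ.weight τ θ m * (1 - riskProb τ m) := by
  rw [weight, outcomeProb, mul_one, Move.arm, toReal_safe, riskProb]

variable (Γ σ) in
/-- The public history `h` has positive probability in the bad state. -/
def Reach (h : List Arm) : Prop := Γ.weight σ .B (h.map Arm.failed) ≠ 0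

theorem Reach.weight_pos (hh : Reach Γ σ h) : 0 < Γ.weight σ .B (h.map Arm.failed) :=
  (Γ.weight_nonneg _ _ _).lt_of_ne' hh

theorem weight_bad_risky (h : List Arm) : Γ.weight σ .B ((Arm.R :: h).map Arm.failed)
    = Γ.weight σ .B (h.map Arm.failed) * riskProb σ (h.map Arm.failed) :=
  mul_one _

theorem reach_nil : Reach Γ σ [] := (Γ.prior_pos .B).ne'

theorem reach_risky_iff :
    Reach Γ σ (.R :: h) ↔ Reach Γ σ h ∧ riskProb σ (h.map Arm.failed) ≠ 0 := by
  rw [Reach, weight_bad_risky, mul_ne_zero_iff, Reach]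

theorem reach_safe_iff :
    Reach Γ σ (.S :: h) ↔ Reach Γ σ h ∧ riskProb σ (h.map Arm.failed) ≠ 1 := by
  rw [Reach, List.map_cons, Arm.failed, weight_safe, mul_ne_zero_iff, Reach, sub_ne_zero,
    ne_comm (a := (1 : ℝ))]

theorem numExp_replicate_append (k : ℕ) (h : List Arm) :
    numExp (List.replicate k .S ++ h) = numExp h := by
  simp [numExp, List.count_replicate]

theorem reach_replicate_append (hh : Reach Γ σ h)
    (hs : ∀ k, riskProb σ ((List.replicate k Arm.S ++ h).map Arm.failed) = 0) (k : ℕ) :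
    Reach Γ σ (List.replicate k .S ++ h) := by
  induction k with
  | zero => exact hh
  | succ k ih => exact reach_safe_iff.2 ⟨ih, (hs k).trans_ne zero_ne_one⟩

/-- Whoever had a success would break a run of two choices of `S`. -/
theorem weight_safe_safe_eq_zero (hSE : Γ.IsSequentialEquilibrium σ π) (θ : State) {m : List Move}
    (hm : Move.risky true ∈ m) : Γ.weight σ θ (.safe :: .safe :: m) = 0 := by
  obtain ⟨j, hj⟩ := exists_successful hm
  rw [weight_safe, weight_safe]
  by_cases hja : j = active m.length
  · rw [riskProb_eq_one_of_successful hSE (hja ▸ hj)]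
    ring
  · rw [riskProb_eq_one_of_successful hSE (m := .safe :: m)
      (by rw [List.length_cons, ← eq_active_succ_of_ne hja]; exact hj.cons _)]
    ring

theorem Consistent.rivalSuccess_eq_zero_of_forall_failed (hC : Γ.Consistent σ π)
    (hno : ∀ m, π i (failView i h) ⟨.G, m⟩ ≠ 0 → m = h.map Arm.failed) :
    rivalSuccess Γ π i h = 0 := by
  have total_le := hC.integral_le (f := fun _ => 1) (C := 1) (k := 0) (by simp) (i := i) (h := h)
    fun m hm hne => absurd (hno m hm) hne
  simp only [failedMean, integral_const, probReal_univ, smul_eq_mul, mul_one, mul_zero,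
    add_zero] at total_le
  have := hC.rivalSuccess_nonneg i h
  rw [rivalSuccess] at *
  linarith

theorem rivalSuccess_safe_safe_eq_zero (hSE : Γ.IsSequentialEquilibrium σ π)
    (hh : Reach Γ σ (.S :: .S :: h)) (i : Player) : rivalSuccess Γ π i (.S :: .S :: h) = 0 := by
  refine hSE.2.rivalSuccess_eq_zero_of_forall_failed fun m hm => ?_
  have arms := map_arm_eq_of_view_eq (hSE.2.compatible hm)
  rw [map_arm_map_failed] at arms
  by_contra hne
  have success : Move.risky true ∈ m := by
    by_contra hno
    exact hne (by rw [← map_failed_map_arm hno, arms])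
  obtain ⟨m', rfl⟩ : ∃ m', m = .safe :: .safe :: m' := by
    obtain _ | ⟨_ | _, _ | ⟨_ | _, m'⟩⟩ := m <;> simp [Move.arm] at arms
    exact ⟨m', rfl⟩
  have unreached := weight_safe_safe_eq_zero hSE .G (by simpa using success)
  exact hm (hSE.2.eq_zero_of_weight_eq_zero unreached
    (m' := (Arm.S :: .S :: h).map Arm.failed) rfl hh)

theorem pubBelief_safe_safe (hSE : Γ.IsSequentialEquilibrium σ π)
    (hh : Reach Γ σ (.S :: .S :: h)) (i : Player) :
    pubBelief π i (.S :: .S :: h) = Γ.φ^[numExp h] Γ.p0 := by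
  have no_success := rivalSuccess_safe_safe_eq_zero hSE hh i
  rw [rivalSuccess, numExp_safe, numExp_safe] at no_success
  have := Γ.odds_pos (numExp h)
  rw [hSE.2.pubBelief_eq, iterate_φ_p0, eq_div_iff (by positivity)]
  linarith

theorem finalBelief_pos (hSE : Γ.IsSequentialEquilibrium σ π) (hh : Reach Γ σ h)
    (hs : ∀ k, riskProb σ ((List.replicate k Arm.S ++ h).map Arm.failed) = 0) :
    0 < Γ.playLaw σ {ω | ∀ i, IsFinalBelief π i ω (Γ.φ^[numExp h] Γ.p0)} := by
  set y : ℕ → FullHist := fun k => ⟨.B, (List.replicate k Arm.S ++ h).map Arm.failed⟩ with hy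
  have start_ne : Γ.evolve σ Γ.init h.length (y 0) ≠ 0 := by
    rw [← List.length_map (f := Arm.failed)]
    refine (Γ.evolve_init_apply σ .B (h.map Arm.failed)).trans_ne ?_
    exact (ENNReal.ofReal_pos.2 hh.weight_pos).ne'
  have step_eq_one (k : ℕ) : Γ.step σ (y k) (y (k + 1)) = 1 := by
    have stops := hs k
    rw [riskProb] at stops
    simp only [hy, List.replicate_succ, List.cons_append, List.map_cons]
    rw [step_apply_cons_self, arm_failed, ← ENNReal.ofReal_toReal (PMF.apply_ne_top (σ _ _) _),
      toReal_safe, stops]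
    simp [Arm.failed, outcomeProb]
  refine (playLaw_path_pos start_ne step_eq_one).trans_le (measure_mono fun ω hω i => ?_)
  refine tendsto_const_nhds.congr' ?_
  filter_upwards [eventually_ge_atTop (h.length + 2)] with n hn
  obtain ⟨k, rfl⟩ : ∃ k, n = h.length + (k + 2) := ⟨n - (h.length + 2), by omega⟩
  have on_path : ω (h.length + (k + 2)) = y (k + 2) := hω (k + 2)
  have belief_eq := pubBelief_safe_safe hSE (h := List.replicate k Arm.S ++ h)
    (reach_replicate_append hh hs (k + 2)) i
  rw [numExp_replicate_append] at belief_eq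
  rw [on_path, ← belief_eq]
  rfl

end Reach

/-! ### Somebody eventually chooses the safe arm -/

section ForcedExperiments

variable {h : List Arm}

/-- Number of failed own experiments in a private history. -/
def ownFailures (v : PrivHist) : ℕ := v.countP (· = Sum.inl (.risky false))

theorem exists_moves_eq_cons_of_step_ne_zero {y z : FullHist} (hz : Γ.step σ y z ≠ 0) :
    ∃ x, z = ⟨y.state, x :: y.moves⟩ := by
  contrapose! hz
  exact Γ.step_apply_eq_zero σ hz

theorem step_goodView_eq_zero {y : FullHist} {e : Move ⊕ Arm} {v : PrivHist}
    (hy : ¬ (y.state = .G ∧ view i y.moves = v)) :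
    (Γ.step σ y).toMeasure {z | z.state = .G ∧ view i z.moves = e :: v} = 0 := by
  rw [PMF.toMeasure_apply_eq_zero_iff _ .of_discrete, Set.disjoint_left]
  rintro z hz ⟨hG, hv⟩
  obtain ⟨x, rfl⟩ := exists_moves_eq_cons_of_step_ne_zero hz
  exact hy ⟨hG, (List.cons.inj hv).2⟩

theorem step_own_failure_le (y : FullHist) (v : PrivHist) :
    (Γ.step σ y).toMeasure {z | z.state = .G ∧ view i z.moves = Sum.inl (.risky false) :: v}
      ≤ ENNReal.ofReal (1 - Γ.lam) := by
  have subset : {z : FullHist | z.state = .G ∧ view i z.moves = Sum.inl (.risky false) :: v}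
      ∩ (Γ.step σ y).support ⊆ {⟨.G, .risky false :: y.moves⟩} := by
    rintro z ⟨⟨hG, hv⟩, hz⟩
    obtain ⟨x, rfl⟩ := exists_moves_eq_cons_of_step_ne_zero hz
    have head_eq := (List.cons.inj hv).1
    split_ifs at head_eq
    cases head_eq
    rw [Set.mem_singleton_iff, ← show y.state = .G from hG]
  refine (PMF.toMeasure_mono _ .of_discrete subset).trans ?_
  rw [PMF.toMeasure_apply_singleton _ _ .of_discrete]
  obtain ⟨_ | _, m⟩ := y
  · rw [step_apply_cons_self]
    exact mul_le_of_le_one_left zero_le (PMF.coe_le_one _ _)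
  · rw [Γ.step_apply_eq_zero σ (by simp)]
    exact zero_le

theorem evolve_goodView_le (σ : Profile) (i : Player) (v : PrivHist) :
    (Γ.evolve σ Γ.init v.length).toMeasure {x | x.state = .G ∧ view i x.moves = v}
      ≤ ENNReal.ofReal (1 - Γ.lam) ^ ownFailures v := by
  induction v with
  | nil => simpa [ownFailures] using prob_le_one
  | cons e v ih =>
    obtain ⟨κ, hκ, step_le⟩ : ∃ κ : ENNReal,
        ENNReal.ofReal (1 - Γ.lam) ^ ownFailures (e :: v)
          = κ * ENNReal.ofReal (1 - Γ.lam) ^ ownFailures v ∧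
        ∀ y, (Γ.step σ y).toMeasure {z | z.state = .G ∧ view i z.moves = e :: v} ≤ κ := by
      by_cases he : e = Sum.inl (.risky false)
      · subst he
        exact ⟨_, by simp [ownFailures, pow_succ'],
          fun y => step_own_failure_le y v⟩
      · exact ⟨1, by simp [ownFailures, he],
          fun y => prob_le_one⟩
    rw [hκ]
    exact (toMeasure_bind_le _ (fun y _ => step_le y) fun y hy => step_goodView_eq_zero hy).trans
      (mul_le_mul_right ih κ)

theorem Consistent.pubBelief_mul_le (hC : Γ.Consistent σ π) (i : Player) (h : List Arm) :
    pubBelief π i h * Γ.weight σ .B (h.map Arm.failed)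
      ≤ (1 - Γ.lam) ^ ownFailures (failView i h) := by
  classical
  have measure_le : (π i (failView i h)).toMeasure {x | x.state = .G}
      * ENNReal.ofReal (Γ.weight σ .B (h.map Arm.failed))
      ≤ ENNReal.ofReal (1 - Γ.lam) ^ ownFailures (failView i h) := by
    refine le_trans ?_ (evolve_goodView_le σ i (failView i h))
    rw [PMF.toMeasure_apply_eq_tsum, PMF.toMeasure_apply_eq_tsum, ← ENNReal.tsum_mul_right]
    refine ENNReal.tsum_le_tsum fun y => ?_
    by_cases hy : y.state = .G ∧ π i (failView i h) y ≠ 0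
    · have hv := hC.compatible hy.2
      rw [Set.indicator_of_mem (by exact hy.1), Set.indicator_of_mem (by exact ⟨hy.1, hv⟩),
        failView, ← hv, length_view, evolve_init_apply, hv]
      exact hC.mul_weight_le y rfl
    · rw [not_and_not_right] at hy
      rw [Set.indicator_apply_eq_zero.2 hy, zero_mul]
      exact zero_le
  have real_le := ENNReal.toReal_mono (by finiteness) measure_le
  rwa [ENNReal.toReal_mul, ENNReal.toReal_ofReal (Γ.weight_nonneg _ _ _), ENNReal.toReal_pow,
    ENNReal.toReal_ofReal (sub_pos.2 Γ.lam_lt_one).le] at real_le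

/-- The public history `h` followed by `k` rounds in which both players experiment. -/
def addRounds (h : List Arm) : ℕ → List Arm
  | 0 => h
  | k + 1 => .R :: .R :: addRounds h k

theorem active_addRounds (h : List Arm) (k : ℕ) :
    active (addRounds h k).length = active h.length := by
  induction k with
  | zero => rfl
  | succ k ih => simpa [addRounds] using ih

theorem numExp_addRounds (h : List Arm) (k : ℕ) :
    numExp (addRounds h k) = numExp h + 2 * k := by
  induction k with
  | zero => rfl
  | succ k ih =>
    rw [addRounds, numExp_risky, numExp_risky, ih]
    omega

theorem ownFailures_failView_addRounds_ge (hi : active h.length = i) (k : ℕ) :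
    k ≤ ownFailures (failView i (addRounds h k)) := by
  induction k with
  | zero => exact Nat.zero_le _
  | succ k ih =>
    have own : active ((addRounds h k).map Arm.failed).length = i := by
      rw [List.length_map, active_addRounds, hi]
    have other : active ((Arm.R :: addRounds h k).map Arm.failed).length ≠ i := by
      rw [← own]
      simpa using active_succ_ne _
    rw [failView, addRounds, List.map_cons, view_cons_other other, List.map_cons,
      view_cons_own own]
    simpa [ownFailures, Arm.failed, failView] using ih

theorem weight_addRounds_eq (hR : ∀ h', numExp h ≤ numExp h' → Reach Γ σ h' →
      riskProb σ (h'.map Arm.failed) = 1) (hh : Reach Γ σ h) (k : ℕ) :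
    Γ.weight σ .B ((addRounds h k).map Arm.failed) = Γ.weight σ .B (h.map Arm.failed) := by
  induction k with
  | zero => rfl
  | succ k ih =>
    have reach : Reach Γ σ (addRounds h k) := by rwa [Reach, ih]
    have first := hR _ (by rw [numExp_addRounds]; omega) reach
    have second := hR (.R :: addRounds h k) (by rw [numExp_risky, numExp_addRounds]; omega)
      (reach_risky_iff.2 ⟨reach, by simp [first]⟩)
    rw [addRounds, weight_bad_risky, weight_bad_risky, first, second, ih, mul_one, mul_one]

/-- Otherwise the failures of a player who experiments forever would push his belief below the
cut-off, at which he stops. -/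
theorem exists_reach_safe (hSE : Γ.IsSequentialEquilibrium σ π) (hR : Γ.RevealingSafe π)
    (hh : Reach Γ σ h) : ∃ h', numExp h ≤ numExp h' ∧ Reach Γ σ (.S :: h') := by
  by_contra! hno
  have forced (h' : List Arm) (hn : numExp h ≤ numExp h') (hr : Reach Γ σ h') :
      riskProb σ (h'.map Arm.failed) = 1 := by
    by_contra h1
    exact hno h' hn (reach_safe_iff.2 ⟨hr, h1⟩)
  have weight_eq := weight_addRounds_eq forced hh
  have zero_le_failure : 0 ≤ 1 - Γ.lam := sub_nonneg.2 Γ.lam_lt_one.le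
  have failure_lt_one : 1 - Γ.lam < 1 := sub_lt_self 1 Γ.lam_pos
  obtain ⟨k, hk⟩ := exists_pow_lt_of_lt_one (mul_pos Γ.pHat_pos hh.weight_pos) failure_lt_one
  have belief_mul_le := hSE.2.pubBelief_mul_le (active h.length) (addRounds h k)
  rw [weight_eq] at belief_mul_le
  have belief_lt : pubBelief π (active h.length) (addRounds h k) < Γ.pHat :=
    lt_of_mul_lt_mul_right ((belief_mul_le.trans (pow_le_pow_of_le_one zero_le_failure
      failure_lt_one.le (ownFailures_failView_addRounds_ge rfl k))).trans_lt hk) hh.weight_pos.le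
  have stops := riskProb_eq_zero_of_pubBelief_lt_pHat hSE hR (h := addRounds h k)
    (by rwa [active_addRounds])
  have go := forced (addRounds h k) (by rw [numExp_addRounds]; omega) (by rwa [Reach, weight_eq])
  exact zero_ne_one (stops.symm.trans go)

end ForcedExperiments

end Play

section Stopping

variable {Γ : ExpGame} {σ : Profile} {π : Beliefs} {i : Player} {h : List Arm}

/-! ### Best replies without hidden successes -/

theorem Consistent.contPayoff_eq (hC : Γ.Consistent σ π) (h0 : rivalSuccess Γ π i h = 0)
    (σ' : Profile) : Γ.contPayoff σ' (π i (failView i h))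
      = badBelief π i h * failedMean Γ (Γ.value σ') h := by
  have upper := hC.integral_le (Γ.abs_value_le σ') (i := i) (h := h)
    fun m _ _ => (abs_le.1 (Γ.abs_value_le σ' ⟨.G, m⟩)).2
  have lower := hC.le_integral (Γ.abs_value_le σ') (i := i) (h := h)
    fun m _ _ => (abs_le.1 (Γ.abs_value_le σ' ⟨.G, m⟩)).1
  rw [h0, zero_mul, add_zero] at upper lower
  rw [contPayoff_eq_integral_value]
  exact le_antisymm upper lower

theorem failedMean_value_update_le (hSE : Γ.IsSequentialEquilibrium σ π)
    (hi : active h.length = i) (h0 : rivalSuccess Γ π i h = 0) (τ : Strategy) :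
    failedMean Γ (Γ.value (Function.update σ i τ)) h ≤ failedMean Γ (Γ.value σ) h := by
  have best_reply := hSE.1 i (h.map Arm.failed) (by simpa using hi) τ
  change Γ.contPayoff _ (π i (failView i h)) ≤ Γ.contPayoff _ (π i (failView i h)) at best_reply
  rw [hSE.2.contPayoff_eq h0, hSE.2.contPayoff_eq h0] at best_reply
  exact le_of_mul_le_mul_left best_reply (badBelief_pos_of_rivalSuccess_eq_zero h0)

theorem failedMean_value_replicate_safe_eq_zero
    (hs : ∀ k, riskProb σ ((List.replicate k Arm.S ++ h).map Arm.failed) = 0) (k : ℕ) :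
    failedMean Γ (Γ.value σ) (List.replicate k Arm.S ++ h) = 0 := by
  have value_eq_zero (θ : State) :
      Γ.value σ ⟨θ, (List.replicate k Arm.S ++ h).map Arm.failed⟩ = 0 := by
    refine Γ.value_eq_zero_of_forall_safe
      (P := fun m => ∃ k, m = (List.replicate k Arm.S ++ h).map Arm.failed) θ ?_ ?_ ⟨k, rfl⟩
    · rintro _ ⟨k, rfl⟩
      exact ⟨hs k, k + 2, rfl⟩
    · rintro _ ⟨k, rfl⟩ h0
      exact absurd (hs (k + 1)) h0
  rw [failedMean, value_eq_zero, value_eq_zero, mul_zero, add_zero]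

/-! ### A single experiment above the one-player cut-off -/

theorem nextMean_value_pureStrategy_good_of_success {c : PrivHist → Prop} {m : List Move}
    (hc : ∀ v, Sum.inl (.risky true) ∈ v → c v) (hi : active m.length = i) :
    Γ.nextMean (Function.update σ i (pureStrategy c))
      (Γ.value (Function.update σ i (pureStrategy c))) ⟨.G, .risky true :: m⟩ = Γ.g := by
  refine nextMean_mem (convex_singleton Γ.g) fun y =>
    value_pureStrategy_good_eq_of_successful hc (by simpa using hi) (Successful.cons ?_ y)
  rw [Successful, view_cons_own hi]
  exact List.mem_cons_self

/-- The rule to experiment at the very beginning, and to go on exactly if this was a success. -/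
def TryingOnce (v : PrivHist) : Prop := v = [] ∨ Sum.inl (.risky true) ∈ v

/-- The profile `σ` with player `0` deviating to the rule `TryingOnce`. -/
noncomputable abbrev tryOnce (σ : Profile) : Profile :=
  Function.update σ (active 0) (pureStrategy TryingOnce)

theorem nextMean_value_tryOnce_failed (θ : State) :
    Γ.nextMean (tryOnce σ) (Γ.value (tryOnce σ)) ⟨θ, [.risky false]⟩ = 0 := by
  refine nextMean_mem (convex_singleton 0) fun y => value_pureStrategy_eq_zero_of_invariant
    (P := fun v => ¬ TryingOnce v) (fun v a hv => ?_) (fun _ hv => hv) (by simp) ?_ θ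
  · simp only [TryingOnce, not_or] at hv ⊢
    simp [hv.2]
  · simp [TryingOnce, view, active]

theorem failedMean_value_tryOnce : failedMean Γ (Γ.value (tryOnce σ)) []
    = Γ.odds 0 * ((1 - Γ.δ) * Γ.g + Γ.δ * (Γ.lam * Γ.g)) - (1 - Γ.δ) * Γ.c := by
  have tries : riskProb (tryOnce σ) [] = 1 := riskProb_pureStrategy_eq_one rfl (.inl rfl)
  have failure : failedMean Γ (Γ.nextMean (tryOnce σ) (Γ.value (tryOnce σ))) [.R] = 0 := by
    simp [failedMean, Arm.failed, nextMean_value_tryOnce_failed]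
  have success : Γ.nextMean (tryOnce σ) (Γ.value (tryOnce σ)) ⟨.G, [.risky true]⟩ = Γ.g :=
    nextMean_value_pureStrategy_good_of_success (fun _ => .inr) rfl
  rw [failedMean_value, List.map_nil, tries, failedMean_armValue_risky, failure, List.map_nil,
    success, numExp, List.count_nil]
  ring

theorem lt_of_pStar_lt_p0 (hp : Γ.pStar < Γ.p0) :
    (1 - Γ.δ) * Γ.c < Γ.odds 0 * ((1 - Γ.δ) * Γ.g + Γ.δ * (Γ.lam * Γ.g)) := by
  have cost_pos := Γ.one_sub_δ_mul_c_pos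
  have gain_pos : 0 < Γ.g * (1 - Γ.δ * (1 - Γ.lam)) :=
    mul_pos Γ.zero_lt_g (sub_pos.2 (mul_lt_one_of_nonneg_of_lt_one_left Γ.δ_pos.le Γ.δ_lt_one
      (sub_le_self 1 Γ.lam_pos.le)))
  rw [pStar, div_lt_iff₀ (by linarith)] at hp
  rw [odds, pow_zero, mul_one, div_mul_eq_mul_div, lt_div_iff₀ (sub_pos.2 Γ.p0_lt_one)]
  linarith

theorem not_forall_safe (hSE : Γ.IsSequentialEquilibrium σ π) (hp : Γ.pStar < Γ.p0) :
    ¬ ∀ k, riskProb σ ((List.replicate k Arm.S).map Arm.failed) = 0 := by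
  intro hs
  have no_hidden_success : rivalSuccess Γ π (active 0) [] = 0 :=
    hSE.2.rivalSuccess_eq_zero_of_forall_failed fun m hm =>
      List.length_eq_zero_iff.1 (by simpa using length_eq_of_view_eq (hSE.2.compatible hm))
  have try_le : failedMean Γ (Γ.value (tryOnce σ)) [] ≤ failedMean Γ (Γ.value σ) [] :=
    failedMean_value_update_le hSE rfl no_hidden_success _
  have stay_eq : failedMean Γ (Γ.value σ) [] = 0 :=
    failedMean_value_replicate_safe_eq_zero (h := []) (by simpa using hs) 0
  rw [stay_eq, failedMean_value_tryOnce] at try_le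
  linarith [lt_of_pStar_lt_p0 hp]

/-! ### Signalling by experimenting -/

/-- With positive probability in the good state, the public history is `h` and player `i` only had
failures, while the other player had a success. -/
def HiddenSuccess (Γ : ExpGame) (σ : Profile) (i : Player) (h : List Arm) : Prop :=
  ∃ m, Γ.weight σ .G m ≠ 0 ∧ Move.risky true ∈ m ∧ view i m = failView i h

theorem weight_good_risky_false_ne_zero {m : List Move} (hm : Γ.weight σ .G m ≠ 0)
    (hr : riskProb σ m = 1) : Γ.weight σ .G (.risky false :: m) ≠ 0 :=
  mul_ne_zero (mul_ne_zero hm (ne_of_eq_of_ne hr one_ne_zero)) (sub_pos.2 Γ.lam_lt_one).ne'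

theorem HiddenSuccess.risky_of_active_ne (hSE : Γ.IsSequentialEquilibrium σ π)
    (hs : HiddenSuccess Γ σ i h) (hi : active h.length ≠ i) : HiddenSuccess Γ σ i (.R :: h) := by
  obtain ⟨m, hm, hmem, hv⟩ := hs
  have hl : m.length = h.length := by simpa using length_eq_of_view_eq hv
  have rival_successful : Successful (active m.length) m := by
    obtain rfl | ⟨j, hj, hs⟩ := eq_map_failed_or_successful_of_view_eq_failView hv
    · exact absurd hmem (risky_true_notMem_map_failed h)
    · obtain rfl : j = active m.length := by rw [hl]; grind
      exact hs
  exact ⟨_, weight_good_risky_false_ne_zero hm (riskProb_eq_one_of_successful hSE rival_successful),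
    List.mem_cons_of_mem _ hmem, view_cons_congr hv _⟩

theorem HiddenSuccess.risky_of_riskProb_eq_one (hs : HiddenSuccess Γ σ i h)
    (hi : active h.length = i) (hr : riskProb σ (h.map Arm.failed) = 1) :
    HiddenSuccess Γ σ i (.R :: h) := by
  obtain ⟨m, hm, hmem, hv⟩ := hs
  have hl : m.length = h.length := by simpa using length_eq_of_view_eq hv
  refine ⟨_, weight_good_risky_false_ne_zero hm ?_, List.mem_cons_of_mem _ hmem,
    view_cons_congr hv _⟩
  rw [← hr]
  exact riskProb_congr (by rw [hl, hi]; exact hv)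

/-- A player at a history that cannot occur unless somebody had a success is convinced that the
state is good. -/
theorem HiddenSuccess.riskProb_eq_one (hSE : Γ.IsSequentialEquilibrium σ π)
    (hs : HiddenSuccess Γ σ i h) (hi : active h.length = i) (hh : ¬ Reach Γ σ h) :
    riskProb σ (h.map Arm.failed) = 1 := by
  obtain ⟨m, hm, -, hv⟩ := hs
  refine riskProb_eq_one_of_sure_good (i := i) (m := h.map Arm.failed) hSE.1 hSE.2.compatible
    (by rwa [List.length_map]) ?_
  rintro ⟨_ | _, m'⟩ hy
  · rfl
  · obtain rfl := hSE.2.eq_map_failed hy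
    have weight_eq_zero : Γ.weight σ .B (h.map Arm.failed) = 0 := not_not.1 hh
    exact absurd (hSE.2.eq_zero_of_weight_eq_zero weight_eq_zero hv hm) hy

theorem hiddenSuccess_safe_risky (hh : Reach Γ σ (.R :: h))
    (h0 : riskProb σ ((Arm.R :: h).map Arm.failed) = 0) :
    HiddenSuccess Γ σ (active (h.length + 1)) (.S :: .R :: h) := by
  refine ⟨.safe :: .risky true :: h.map Arm.failed, ?_, by simp, view_cons_congr ?_ .safe⟩
  · have success_possible : Γ.weight σ .G (.risky true :: h.map Arm.failed) ≠ 0 := by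
      obtain ⟨h_reach, h_risky⟩ := reach_risky_iff.1 hh
      refine mul_ne_zero (mul_ne_zero ?_ h_risky) Γ.lam_pos.ne'
      rw [weight_good_map_failed]
      exact mul_ne_zero (Γ.odds_pos _).ne' h_reach
    rw [weight_safe, riskProb_risky true false]
    change riskProb σ (.risky false :: h.map Arm.failed) = 0 at h0
    rwa [h0, sub_zero, mul_one]
  · have hi : active (h.map Arm.failed).length ≠ active (h.length + 1) := by
      simpa using (active_succ_ne _).symm
    rw [List.map_cons, view_cons_other hi, view_cons_other hi]
    rfl

theorem not_reach_risky_addRounds (h1 : riskProb σ (h.map Arm.failed) = 0) (k : ℕ) :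
    ¬ Reach Γ σ (.R :: addRounds h k) := by
  induction k with
  | zero => exact fun hr => (reach_risky_iff.1 hr).2 h1
  | succ k ih => exact fun hr => ih (reach_risky_iff.1 (reach_risky_iff.1 hr).1).1

/-- If failing players stop at `h`, then the experiments of a player who had a success convince the
other player. -/
theorem HiddenSuccess.riskProb_risky_addRounds_eq_one (hSE : Γ.IsSequentialEquilibrium σ π)
    (hs : HiddenSuccess Γ σ i h) (hi : active h.length ≠ i)
    (h0 : riskProb σ (h.map Arm.failed) = 0) (k : ℕ) :
    riskProb σ ((Arm.R :: addRounds h k).map Arm.failed) = 1 := by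
  have not_active (k : ℕ) : active (addRounds h k).length ≠ i := by rwa [active_addRounds]
  have is_active (k : ℕ) : active (Arm.R :: addRounds h k).length = i :=
    (eq_active_succ_of_ne (not_active k).symm).symm
  have convinced {k : ℕ} (hk : HiddenSuccess Γ σ i (.R :: addRounds h k)) :
      riskProb σ ((Arm.R :: addRounds h k).map Arm.failed) = 1 :=
    hk.riskProb_eq_one hSE (is_active k) (not_reach_risky_addRounds h0 k)
  have hidden (k : ℕ) : HiddenSuccess Γ σ i (addRounds h k) := by
    induction k with
    | zero => exact hs
    | succ k ih =>
      have resumed := ih.risky_of_active_ne hSE (not_active k)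
      exact resumed.risky_of_riskProb_eq_one (is_active k) (convinced resumed)
  exact convinced ((hidden k).risky_of_active_ne hSE (not_active k))

end Stopping

/-! ### The payoff of a sequence of experiments that the other player answers -/

section ProbingPayoff

variable (Γ : ExpGame)

/-- Lower bound for the payoff, in the good state, of an unsuccessful player who experiments for
`d` more rounds and then probes the other player by choosing `S`, if the other player had a
success. -/
noncomputable def informedPayoff : ℕ → ℝ
  | 0 => Γ.δ * Γ.g
  | d + 1 => (1 - Γ.δ) * Γ.g + Γ.δ * (Γ.lam * Γ.g + (1 - Γ.lam) * informedPayoff d)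

/-- The counterpart of `informedPayoff` if the other player had no success yet, but experiments
in each of the `d` rounds. -/
noncomputable def uninformedPayoff : ℕ → ℝ
  | 0 => 0
  | d + 1 => (1 - Γ.δ) * Γ.g + Γ.δ * (Γ.lam * Γ.g + (1 - Γ.lam) *
      (Γ.lam * Γ.informedPayoff d + (1 - Γ.lam) * uninformedPayoff d))

/-- The counterpart of `uninformedPayoff` in the bad state. -/
noncomputable def lossPayoff : ℕ → ℝ
  | 0 => 0
  | d + 1 => -((1 - Γ.δ) * Γ.c) + Γ.δ * lossPayoff d

variable {Γ} {Q : ℝ}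

/-- `Q * w ^ 2` and `Q * w * (1 - w)` stand for the odds that the state is good and, respectively,
that no experiment succeeded so far and that only the other player had a success. -/
theorem δ_mul_le_probing_total (hQ : 0 ≤ Q) (d : ℕ) {w : ℝ} (hw : 0 ≤ w) (hw1 : w ≤ 1)
    (hd : ∀ k < d, (1 - Γ.δ) * Γ.c ≤ Q * (w * (1 - Γ.lam) ^ k) ^ 2 * Γ.encouragedGain) :
    Γ.δ * (Q * w * (1 - w)) * Γ.g ≤ Γ.lossPayoff d + Q * w ^ 2 * Γ.uninformedPayoff d
      + Q * w * (1 - w) * Γ.informedPayoff d := by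
  induction d generalizing w with
  | zero =>
    simp only [lossPayoff, uninformedPayoff, informedPayoff]
    exact le_of_eq (by ring)
  | succ d ih =>
    have failure_pos : 0 < 1 - Γ.lam := sub_pos.2 Γ.lam_lt_one
    have failure_le : 1 - Γ.lam ≤ 1 := sub_le_self 1 Γ.lam_pos.le
    have tail := mul_le_mul_of_nonneg_left (ih (w := w * (1 - Γ.lam))
      (mul_nonneg hw failure_pos.le) (mul_le_one₀ hw1 failure_pos.le failure_le) fun k hk => by
        rw [mul_assoc w, ← pow_succ']
        exact hd (k + 1) (by omega)) Γ.δ_pos.le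
    have head := hd 0 (Nat.succ_pos d)
    have slack_nonneg :
        0 ≤ Q * w * Γ.g * ((1 - w) * ((1 - Γ.δ) * (1 - Γ.δ * (1 - Γ.lam)))) := by
      have := Γ.zero_lt_g
      have := sub_nonneg.2 hw1
      have := sub_nonneg.2 Γ.δ_lt_one.le
      have := sub_nonneg.2 (mul_le_one₀ Γ.δ_lt_one.le failure_pos.le failure_le)
      positivity
    simp only [lossPayoff, uninformedPayoff, informedPayoff, encouragedGain, pow_zero,
      mul_one] at *
    linarith

theorem probing_total_pos {K : ℕ} (hK0 : K ≠ 0)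
    (hQ : (1 - Γ.δ) * Γ.c < Q * Γ.encouragedGain)
    (hK : ∀ k < K, (1 - Γ.δ) * Γ.c ≤ Q * (1 - Γ.lam) ^ (2 * k) * Γ.encouragedGain) :
    0 < Γ.lossPayoff K + Q * Γ.uninformedPayoff K := by
  obtain ⟨d, rfl⟩ := Nat.exists_eq_succ_of_ne_zero hK0
  have hQ0 : 0 ≤ Q :=
    (pos_of_mul_pos_left (Γ.one_sub_δ_mul_c_pos.trans hQ) Γ.encouragedGain_pos.le).le
  have tail := mul_le_mul_of_nonneg_left (δ_mul_le_probing_total hQ0 d (w := 1 - Γ.lam)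
    (sub_nonneg.2 Γ.lam_lt_one.le) (sub_le_self 1 Γ.lam_pos.le) fun k hk => by
      rw [← pow_succ', ← pow_mul, mul_comm (k + 1)]
      exact hK (k + 1) (by omega)) Γ.δ_pos.le
  simp only [lossPayoff, uninformedPayoff]
  rw [encouragedGain] at hQ
  linarith

end ProbingPayoff

section Cutoff

variable {Γ : ExpGame} {σ : Profile} {π : Beliefs} {i : Player} {h : List Arm}

section Probe

variable {N d : ℕ} {m : List Move}

theorem value_probe_eq_armValue_risky (hi : active m.length = i) (hN : m.length < N)
    (θ : State) : Γ.value (probe σ i N) ⟨θ, m⟩ = Γ.armValue (probe σ i N) ⟨θ, m⟩ .R := by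
  rw [value_eq_armValue,
    riskProb_pureStrategy_eq_one hi (.inr (.inl (by rwa [length_view]))), sub_self, zero_mul,
    zero_add, one_mul]

theorem value_probe_good_eq (hi : active m.length = i) (hN : m.length < N) :
    Γ.value (probe σ i N) ⟨.G, m⟩ = (1 - Γ.δ) * Γ.g + Γ.δ * (Γ.lam * Γ.g + (1 - Γ.lam) *
      Γ.nextMean (probe σ i N) (Γ.value (probe σ i N)) ⟨.G, .risky false :: m⟩) := by
  rw [value_probe_eq_armValue_risky hi hN]
  simp only [armValue, gain, outcomeMean,
    nextMean_value_pureStrategy_good_of_success (c := Probing N) (fun _ => .inl) hi]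

theorem nextMean_probe_of_riskProb_eq_one (hi : active m.length ≠ i) (hr : riskProb σ m = 1)
    (f : FullHist → ℝ) (θ : State) : Γ.nextMean (probe σ i N) f ⟨θ, m⟩
      = Γ.outcomeMean θ fun y => f ⟨θ, y :: m⟩ := by
  rw [nextMean, riskProb_update_other hi, hr, sub_self, zero_mul, zero_add, one_mul]

theorem informedPayoff_le_value_probe (hSE : Γ.IsSequentialEquilibrium σ π)
    (hi : active m.length = i) (hN : m.length + 2 * d = N)
    (hs : Successful (active (m.length + 1)) m) :
    Γ.informedPayoff d ≤ Γ.value (probe σ i N) ⟨.G, m⟩ := by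
  induction d generalizing m with
  | zero => exact δ_mul_g_le_value_probe hi hN (riskProb_eq_one_of_successful hSE (hs.cons .safe))
  | succ d ih =>
    have tail : Γ.informedPayoff d
        ≤ Γ.nextMean (probe σ i N) (Γ.value (probe σ i N)) ⟨.G, .risky false :: m⟩ :=
      le_nextMean fun y => ih (by simpa using hi) (by simp only [List.length_cons]; omega)
        (by simpa using (hs.cons (.risky false)).cons y)
    rw [value_probe_good_eq hi (by omega), informedPayoff]
    have := Γ.δ_pos
    have := sub_pos.2 Γ.lam_lt_one
    gcongr

theorem addRounds_risky_risky (h : List Arm) (k : ℕ) :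
    addRounds (.R :: .R :: h) k = addRounds h (k + 1) := by
  induction k with
  | zero => rfl
  | succ k ih => rw [addRounds, ih, ← addRounds]

theorem lossPayoff_le_value_probe (hi : active h.length = i) (hN : h.length + 2 * d = N)
    (hr : ∀ k < d, riskProb σ ((Arm.R :: addRounds h k).map Arm.failed) = 1)
    (hs : riskProb σ ((Arm.S :: addRounds h d).map Arm.failed) = 0) :
    Γ.lossPayoff d ≤ Γ.value (probe σ i N) ⟨.B, h.map Arm.failed⟩ := by
  induction d generalizing h with
  | zero =>
    exact (value_probe_eq_zero (by simpa using hi) (by simpa using hN)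
      (not_successful_map_failed i h) hs .B).ge
  | succ d ih =>
    have tail := ih (h := .R :: .R :: h) (by simpa using hi)
      (by simp only [List.length_cons]; omega)
      (fun k hk => by rw [addRounds_risky_risky]; exact hr (k + 1) (by omega))
      (by rwa [addRounds_risky_risky])
    have own : active (h.map Arm.failed).length = i := by rwa [List.length_map]
    have other : active (Move.risky false :: h.map Arm.failed).length ≠ i :=
      own ▸ active_succ_ne _
    have rival_risks : riskProb σ (.risky false :: h.map Arm.failed) = 1 := hr 0 d.succ_pos
    rw [value_probe_eq_armValue_risky own (by rw [List.length_map]; omega), armValue, outcomeMean,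
      nextMean_probe_of_riskProb_eq_one other rival_risks,
      lossPayoff, outcomeMean]
    simp only [gain, mul_neg]
    exact add_le_add_right (mul_le_mul_of_nonneg_left tail Γ.δ_pos.le) _

theorem uninformedPayoff_le_value_probe (hSE : Γ.IsSequentialEquilibrium σ π)
    (hi : active h.length = i) (hN : h.length + 2 * d = N)
    (hr : ∀ k < d, riskProb σ ((Arm.R :: addRounds h k).map Arm.failed) = 1)
    (hs : riskProb σ ((Arm.S :: addRounds h d).map Arm.failed) = 0) :
    Γ.uninformedPayoff d ≤ Γ.value (probe σ i N) ⟨.G, h.map Arm.failed⟩ := by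
  induction d generalizing h with
  | zero =>
    exact (value_probe_eq_zero (by simpa using hi) (by simpa using hN)
      (not_successful_map_failed i h) hs .G).ge
  | succ d ih =>
    have tail := ih (h := .R :: .R :: h) (by simpa using hi)
      (by simp only [List.length_cons]; omega)
      (fun k hk => by rw [addRounds_risky_risky]; exact hr (k + 1) (by omega))
      (by rwa [addRounds_risky_risky])
    have own : active (h.map Arm.failed).length = i := by rwa [List.length_map]
    have other : active (Move.risky false :: h.map Arm.failed).length ≠ i :=
      own ▸ active_succ_ne _
    have rival_risks : riskProb σ (.risky false :: h.map Arm.failed) = 1 := hr 0 d.succ_pos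
    have informed_tail : Γ.informedPayoff d ≤ Γ.value (probe σ i N)
        ⟨.G, .risky true :: .risky false :: h.map Arm.failed⟩ := by
      refine informedPayoff_le_value_probe hSE (by simpa using hi)
        (by simp only [List.length_cons, List.length_map]; omega) ?_
      rw [Successful, view_cons_own (by simp)]
      exact List.mem_cons_self
    rw [value_probe_good_eq own (by rw [List.length_map]; omega),
      nextMean_probe_of_riskProb_eq_one other rival_risks,
      uninformedPayoff, outcomeMean]
    have := Γ.δ_pos
    have := Γ.lam_pos
    have := sub_pos.2 Γ.lam_lt_one
    gcongr
    exact tail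

end Probe

/-! ### Unsuccessful players do not stop above the cut-off -/

variable (Γ) in
theorem exists_rounds_to_cutoff {n : ℕ}
    (hn : (1 - Γ.δ) * Γ.c < Γ.odds n * Γ.encouragedGain) :
    ∃ K ≠ 0, Γ.odds (n + 2 * K) * Γ.encouragedGain < (1 - Γ.δ) * Γ.c ∧
      ∀ k < K, (1 - Γ.δ) * Γ.c ≤ Γ.odds n * (1 - Γ.lam) ^ (2 * k) * Γ.encouragedGain := by
  classical
  have exists_below : ∃ K, Γ.odds (n + 2 * K) * Γ.encouragedGain < (1 - Γ.δ) * Γ.c := by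
    obtain ⟨N, hN⟩ := Γ.exists_odds_mul_lt Γ.encouragedGain Γ.one_sub_δ_mul_c_pos
    exact ⟨N, (mul_le_mul_of_nonneg_right (Γ.odds_antitone (by omega))
      Γ.encouragedGain_pos.le).trans_lt hN⟩
  refine ⟨Nat.find exists_below, fun h0 => ?_, Nat.find_spec exists_below, fun k hk => ?_⟩
  · have := Nat.find_spec exists_below
    rw [h0] at this
    exact this.not_gt hn
  · have odds_add : Γ.odds (n + 2 * k) = Γ.odds n * (1 - Γ.lam) ^ (2 * k) := by
      rw [odds, odds, pow_add]
      ring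
    rw [← odds_add]
    exact not_lt.1 (Nat.find_min exists_below hk)

theorem odds_le_of_forall_safe (hSE : Γ.IsSequentialEquilibrium σ π) (hR : Γ.RevealingSafe π)
    (hh : Reach Γ σ (.R :: h))
    (hs : ∀ k, riskProb σ ((List.replicate k Arm.S ++ .R :: h).map Arm.failed) = 0) :
    Γ.odds (numExp (.R :: h)) * Γ.encouragedGain ≤ (1 - Γ.δ) * Γ.c := by
  by_contra! high_odds
  obtain ⟨K, hK0, hKlow, hK⟩ := Γ.exists_rounds_to_cutoff high_odds
  set H : List Arm := .S :: .R :: h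
  set i := active H.length with hi
  have convinced (k : ℕ) : riskProb σ ((Arm.R :: addRounds H k).map Arm.failed) = 1 :=
    (hiddenSuccess_safe_risky hh (hs 0)).riskProb_risky_addRounds_eq_one hSE
      (by simpa [H] using (active_succ_ne _).symm) (hs 1) k
  have stops : riskProb σ ((Arm.S :: addRounds H K).map Arm.failed) = 0 :=
    riskProb_safe_eq_zero_of_low_odds hSE hR (by rwa [numExp_addRounds, numExp_safe])
  have no_hidden_success : rivalSuccess Γ π i H = 0 := by
    refine hSE.2.rivalSuccess_eq_zero ?_
    rw [numExp_safe]
    exact hR (.R :: h)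
  have probe_le := failedMean_value_update_le hSE hi.symm no_hidden_success
    (pureStrategy (Probing (H.length + 2 * K)))
  have stay_eq : failedMean Γ (Γ.value σ) H = 0 := failedMean_value_replicate_safe_eq_zero hs 1
  have loss_le := lossPayoff_le_value_probe (Γ := Γ) hi.symm rfl (fun k _ => convinced k) stops
  have gain_le := mul_le_mul_of_nonneg_left
    (uninformedPayoff_le_value_probe hSE hi.symm rfl (fun k _ => convinced k) stops)
    (Γ.odds_pos (numExp (.R :: h))).le
  rw [stay_eq, failedMean, numExp_safe] at probe_le
  linarith [probing_total_pos hK0 high_odds hK]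

/-! ### Histories at which experimentation ends -/

theorem exists_reach_risky_of_numExp_ne_zero (hh : Reach Γ σ h) (hn : numExp h ≠ 0) :
    ∃ h', numExp (.R :: h') = numExp h ∧ Reach Γ σ (.R :: h') := by
  induction h with
  | nil => exact absurd rfl hn
  | cons a h ih =>
    cases a
    · rw [numExp_safe] at hn ⊢
      exact ih (reach_safe_iff.1 hh).1 hn
    · exact ⟨h, rfl, hh⟩

theorem riskProb_replicate_safe_eq_zero (hh : Reach Γ σ h)
    (h0 : ∀ h', Reach Γ σ h' → numExp h' = numExp h → riskProb σ (h'.map Arm.failed) = 0)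
    (k : ℕ) : riskProb σ ((List.replicate k Arm.S ++ h).map Arm.failed) = 0 := by
  suffices reach : Reach Γ σ (List.replicate k .S ++ h) from
    h0 _ reach (numExp_replicate_append k h)
  induction k with
  | zero => exact hh
  | succ k ih =>
    rw [List.replicate_succ, List.cons_append, reach_safe_iff,
      h0 _ ih (numExp_replicate_append k h)]
    exact ⟨ih, zero_ne_one⟩

theorem exists_final_history_of_lt_pHat (hSE : Γ.IsSequentialEquilibrium σ π)
    (hR : Γ.RevealingSafe π) (hh : Reach Γ σ h) (hlt : Γ.φ^[numExp h] Γ.p0 < Γ.pHat) :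
    ∃ h', Reach Γ σ h' ∧ Γ.φ^[numExp h'] Γ.p0 ≤ Γ.pHat ∧
      ∀ k, riskProb σ ((List.replicate k Arm.S ++ h').map Arm.failed) = 0 := by
  obtain ⟨h', hn, hh'⟩ := exists_reach_safe hSE hR hh
  rw [iterate_φ_p0_lt_pHat_iff] at hlt
  have low_odds := (mul_le_mul_of_nonneg_right (Γ.odds_antitone hn)
    Γ.encouragedGain_pos.le).trans_lt hlt
  refine ⟨.S :: h', hh', ?_, fun k => ?_⟩
  · rw [numExp_safe]
    exact ((Γ.iterate_φ_p0_lt_pHat_iff _).2 low_odds).le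
  · have safe_first : List.replicate k Arm.S ++ .S :: h' = .S :: (List.replicate k .S ++ h') := by
      rw [← List.cons_append, ← List.replicate_succ, List.replicate_succ', List.append_assoc]
      rfl
    rw [safe_first]
    exact riskProb_safe_eq_zero_of_low_odds hSE hR (by rwa [numExp_replicate_append])

theorem exists_reach_numExp_max
    (hlow : ∀ h, Reach Γ σ h → Γ.pHat ≤ Γ.φ^[numExp h] Γ.p0) :
    ∃ h, Reach Γ σ h ∧ ∀ h', Reach Γ σ h' → numExp h' ≤ numExp h := by
  classical
  obtain ⟨N, hN⟩ := Γ.exists_odds_mul_lt Γ.encouragedGain Γ.one_sub_δ_mul_c_pos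
  have numExp_le (h : List Arm) (hh : Reach Γ σ h) : numExp h ≤ N := by
    by_contra! hlt
    exact (hlow h hh).not_gt <| (Γ.iterate_φ_p0_lt_pHat_iff _).2 <|
      (mul_le_mul_of_nonneg_right (Γ.odds_antitone hlt.le) Γ.encouragedGain_pos.le).trans_lt hN
  obtain ⟨h, hh, hn⟩ := Nat.findGreatest_spec (P := fun n => ∃ h, Reach Γ σ h ∧ numExp h = n)
    (Nat.zero_le N) ⟨[], reach_nil, rfl⟩
  exact ⟨h, hh, fun h' hh' => hn ▸ Nat.le_findGreatest (numExp_le h' hh') ⟨h', hh', rfl⟩⟩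

theorem exists_final_history (hSE : Γ.IsSequentialEquilibrium σ π) (hR : Γ.RevealingSafe π)
    (hp : Γ.pStar < Γ.p0) : ∃ h, Reach Γ σ h ∧ Γ.φ^[numExp h] Γ.p0 ≤ Γ.pHat ∧
      ∀ k, riskProb σ ((List.replicate k Arm.S ++ h).map Arm.failed) = 0 := by
  by_cases hlow : ∃ h, Reach Γ σ h ∧ Γ.φ^[numExp h] Γ.p0 < Γ.pHat
  · obtain ⟨h, hh, hlt⟩ := hlow
    exact exists_final_history_of_lt_pHat hSE hR hh hlt
  push Not at hlow
  obtain ⟨h, hh, hmax⟩ := exists_reach_numExp_max hlow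
  have stops (h' : List Arm) (hh' : Reach Γ σ h') (hn : numExp h' = numExp h) :
      riskProb σ (h'.map Arm.failed) = 0 := by
    by_contra h0
    have := hmax _ (reach_risky_iff.2 ⟨hh', h0⟩)
    rw [numExp_risky] at this
    omega
  have numExp_ne_zero : numExp h ≠ 0 := fun hn => not_forall_safe hSE hp <| by
    simpa using riskProb_replicate_safe_eq_zero reach_nil fun h' hh' hn' =>
      stops h' hh' (hn'.trans hn.symm)
  obtain ⟨h', hn', hh'⟩ := exists_reach_risky_of_numExp_ne_zero hh numExp_ne_zero
  have forever := riskProb_replicate_safe_eq_zero hh' fun h'' hh'' hn'' =>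
    stops h'' hh'' (hn''.trans hn')
  refine ⟨.R :: h', hh', ?_, forever⟩
  exact not_lt.1 fun hlt => (odds_le_of_forall_safe hSE hR hh' forever).not_gt
    ((Γ.pHat_lt_iterate_φ_p0_iff _).1 hlt)

end Cutoff

end ExpGame

theorem mainTheorem2_general (Γ : ExpGame) (σ : ExpGame.Profile) (π : ExpGame.Beliefs)
    (hSE : Γ.IsSequentialEquilibrium σ π) (hR : Γ.RevealingSafe π) :
    (Γ.pStar < Γ.p0 →
      0 < Γ.playLaw σ {ω | ∀ i, ∃ ℓ ≤ Γ.pHat, ExpGame.IsFinalBelief π i ω ℓ} ∧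
      ((∀ n : ℕ, Γ.φ^[n] Γ.p0 ≠ Γ.pHat) →
        0 < Γ.playLaw σ {ω | ∀ i, ∃ ℓ < Γ.pHat, ExpGame.IsFinalBelief π i ω ℓ})) ∧
    ∀ h : List ExpGame.Arm,
      ExpGame.pubBelief π (ExpGame.active h.length) h < Γ.pHat →
        σ (ExpGame.active h.length) (ExpGame.failView (ExpGame.active h.length) h) ExpGame.Arm.R
          = 0 := by
  refine ⟨fun hp => ?_, fun h hlt => ?_⟩
  · obtain ⟨h, hh, hle, hs⟩ := ExpGame.exists_final_history hSE hR hp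
    have hpos := ExpGame.finalBelief_pos hSE hh hs
    refine ⟨hpos.trans_le (measure_mono fun ω hω i => ⟨_, hle, hω i⟩), fun hne => ?_⟩
    exact hpos.trans_le (measure_mono fun ω hω i => ⟨_, lt_of_le_of_ne hle (hne _), hω i⟩)
  · have h0 := ExpGame.riskProb_eq_zero_of_pubBelief_lt_pHat hSE hR hlt
    rw [ExpGame.riskProb_map_failed, ENNReal.toReal_eq_zero_iff] at h0
    exact h0.resolve_right (PMF.apply_ne_top _ _)

theorem mainTheorem2 (Γ : ExpGame) (σ : ExpGame.Profile) (π : ExpGame.Beliefs)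
    (hSE : Γ.IsSequentialEquilibrium σ π) (hR : Γ.Reasonable π) :
    (Γ.pStar < Γ.p0 →
      0 < Γ.playLaw σ {ω | ∀ i, ∃ ℓ ≤ Γ.pHat, ExpGame.IsFinalBelief π i ω ℓ} ∧
      ((∀ n : ℕ, Γ.φ^[n] Γ.p0 ≠ Γ.pHat) →
        0 < Γ.playLaw σ {ω | ∀ i, ∃ ℓ < Γ.pHat, ExpGame.IsFinalBelief π i ω ℓ})) ∧
    ∀ h : List ExpGame.Arm,
      ExpGame.pubBelief π (ExpGame.active h.length) h < Γ.pHat →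
        σ (ExpGame.active h.length) (ExpGame.failView (ExpGame.active h.length) h) ExpGame.Arm.R
          = 0 :=
  mainTheorem2_general Γ σ π hSE fun h => (hR h).1
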